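/- Let $(X,\mathcal B,\mu)$ be a standard Borel space with a non-atomic probability measure, and let $\mathrm{Aut}$ be the group of its invertible measure-preserving transformations, where transformations that agree almost everywhere are identified. Let $\{A_i\}_{i\ge 0}$ be a sequence of measurable sets that is dense in $\mathcal B$ for the distance $\mu(A\,\Delta\,B)$, and equip $\mathrm{Aut}$ with the Halmos metric $$\rho(S,T)=\sum_{i\ge 0} 2^{-i-1}\bigl(\mu(SA_i\,\Delta\, TA_i)+\mu(S^{-1}A_i\,\Delta\, T^{-1}A_i)\bigr).$$ A property of transformations is called generic if the set of $T\in\mathrm{Aut}$ that have it contains a dense $G_\delta$ subset of $(\mathrm{Aut},\rho)$. A geometric figure in $\mathbb R^d$ is a bounded set $F\subset\mathbb R^d$ whose boundary has upper box dimension less than $d$, i.e. there are $C$ and $s>0$ such that the $r$-neighbourhood of $\partial F$ has volume at most $Cr^s$ for all $0<r\le 1$ (for example a polytope, a convex body, or a bounded domain with piecewise smooth boundary). An isometric exchange of a finite collection of sets $F_1,\dots,F_n\subset\mathbb R^d$ is given by isometries $g_1,\dots,g_n$ of $\mathbb R^d$ such that, up to null sets, the $F_i$ are pairwise disjoint, the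 $g_i(F_i)$ are pairwise disjoint, and $\bigcup_i g_i(F_i)=\bigcup_i F_i=:Y$, where $Y$ has positive volume; it is the transformation of $Y$, with normalized Lebesgue measure, that equals $g_i$ on $F_i$. It is a rectangle exchange if every $F_i$ is a non-degenerate $d$-dimensional rectangular box, in any position and with any part of its boundary included. Then the following property of $T\in\mathrm{Aut}$ is generic: for every $d$, $T$ is not isomorphic (modulo null sets) to any isometric exchange of a finite collection of geometric figures in $\mathbb R^d$. In particular, it is a generic property of $T$ that, for every $d$, $T$ is not isomorphic to any rectangle exchange in $\mathbb R^d$. -/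

import Mathlib

open MeasureTheory Set Filter
open scoped symmDiff

noncomputable section

namespace GenericExchange

/-! ### The group of automorphisms of a probability space, with the Halmos metric -/

section Automorphisms

variable {X : Type*} [MeasurableSpace X]

/-- An invertible measure-preserving transformation of `(X, μ)`. -/
def MPEquiv (μ : Measure X) : Type _ := {T : X ≃ᵐ X // MeasurePreserving T μ μ}

/-- Transformations that agree almost everywhere are identified. -/
instance aeSetoid (μ : Measure X) : Setoid (MPEquiv μ) where
  r S T := ∀ᵐ x ∂μ, S.1 x = T.1 x
  iseqv :=
    { refl := fun _ => Eventually.of_forall fun _ => rfl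
      symm := fun h => h.mono fun _ hx => hx.symm
      trans := fun h k => by
        filter_upwards [h, k] with x hx kx
        exact hx.trans kx }

/-- The automorphisms of `(X, μ)`: invertible measure-preserving transformations modulo
almost everywhere equality. -/
def Aut (μ : Measure X) : Type _ := Quotient (aeSetoid μ)

/-- A sequence of measurable sets that is dense in the measure algebra of `μ`. -/
def IsDenseFamily (μ : Measure X) (A : ℕ → Set X) : Prop :=
  (∀ i, MeasurableSet (A i)) ∧
    ∀ B : Set X, MeasurableSet B → ∀ ε : ℝ, 0 < ε → ∃ i, μ.real (A i ∆ B) < ε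

/-- The `i`-th term of the Halmos metric, `μ(SAᵢ ∆ TAᵢ) + μ(S⁻¹Aᵢ ∆ T⁻¹Aᵢ)`. -/
def halmosTerm (μ : Measure X) (A : ℕ → Set X) (S T : MPEquiv μ) (i : ℕ) : ℝ :=
  μ.real ((S.1 '' A i) ∆ (T.1 '' A i)) + μ.real ((S.1 ⁻¹' A i) ∆ (T.1 ⁻¹' A i))

/-- The Halmos metric on representatives; the weights `2⁻ⁱ⁻¹` make the series converge. -/
def preHalmosDist (μ : Measure X) (A : ℕ → Set X) (S T : MPEquiv μ) : ℝ :=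
  ∑' i, (1 / 2 : ℝ) ^ (i + 1) * halmosTerm μ A S T i

theorem preimage_ae_eq {μ : Measure X} {S S' : MPEquiv μ} (h : S ≈ S') (B : Set X) :
    S.1 ⁻¹' B =ᵐ[μ] S'.1 ⁻¹' B := by
  have h' : ∀ᵐ x ∂μ, S.1 x = S'.1 x := h
  filter_upwards [h'] with x hx
  change (S.1 x ∈ B) = (S'.1 x ∈ B)
  rw [hx]

theorem image_ae_eq {μ : Measure X} {S S' : MPEquiv μ} (h : S ≈ S') (B : Set X) :
    S.1 '' B =ᵐ[μ] S'.1 '' B := by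
  have h' : ∀ᵐ x ∂μ, S.1 x = S'.1 x := h
  have hs : ∀ᵐ y ∂μ, S.1 (S.1.symm y) = S'.1 (S.1.symm y) :=
    (S.2.symm S.1).quasiMeasurePreserving.ae h'
  rw [S.1.image_eq_preimage_symm, S'.1.image_eq_preimage_symm]
  filter_upwards [hs] with y hy
  change (S.1.symm y ∈ B) = (S'.1.symm y ∈ B)
  have hy' : S'.1.symm y = S.1.symm y := by
    rw [S.1.apply_symm_apply] at hy
    rw [MeasurableEquiv.symm_apply_eq]
    exact hy
  rw [hy']

theorem preHalmosDist_congr {μ : Measure X} (A : ℕ → Set X) (S T S' T' : MPEquiv μ)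
    (hS : S ≈ S') (hT : T ≈ T') : preHalmosDist μ A S T = preHalmosDist μ A S' T' := by
  refine tsum_congr fun i => ?_
  have h1 := measureReal_congr ((image_ae_eq hS (A i)).symmDiff (image_ae_eq hT (A i)))
  have h2 := measureReal_congr ((preimage_ae_eq hS (A i)).symmDiff (preimage_ae_eq hT (A i)))
  simp only [halmosTerm, h1, h2]

/-- The Halmos metric `ρ(S, T) = ∑ 2⁻ⁱ⁻¹ (μ(SAᵢ ∆ TAᵢ) + μ(S⁻¹Aᵢ ∆ T⁻¹Aᵢ))`. -/
def halmosDist (μ : Measure X) (A : ℕ → Set X) (S T : Aut μ) : ℝ :=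
  Quotient.lift₂ (preHalmosDist μ A) (preHalmosDist_congr A) S T

theorem summable_halmos (μ : Measure X) [IsProbabilityMeasure μ] (A : ℕ → Set X)
    (S T : MPEquiv μ) :
    Summable fun i => (1 / 2 : ℝ) ^ (i + 1) * halmosTerm μ A S T i := by
  have hg : Summable fun i : ℕ => (1 / 2 : ℝ) ^ i := summable_geometric_two
  refine Summable.of_nonneg_of_le (fun i => ?_) (fun i => ?_) hg
  · exact mul_nonneg (by positivity) (add_nonneg measureReal_nonneg measureReal_nonneg)
  · have h : halmosTerm μ A S T i ≤ 1 + 1 := add_le_add measureReal_le_one measureReal_le_one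
    have hp : (0 : ℝ) ≤ (1 / 2 : ℝ) ^ (i + 1) := by positivity
    calc (1 / 2 : ℝ) ^ (i + 1) * halmosTerm μ A S T i ≤ (1 / 2 : ℝ) ^ (i + 1) * (1 + 1) :=
          mul_le_mul_of_nonneg_left h hp
      _ = (1 / 2 : ℝ) ^ i := by ring

/-- The space of automorphisms with the Halmos metric. (When the family `A` is dense, distance
zero means equality; only the induced topology is used below.) -/
@[reducible]
def halmosMetric (μ : Measure X) [IsProbabilityMeasure μ] (A : ℕ → Set X) :
    PseudoMetricSpace (Aut μ) where
  dist := halmosDist μ A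
  dist_self := by
    rintro ⟨S⟩
    change preHalmosDist μ A S S = 0
    simp [preHalmosDist, halmosTerm]
  dist_comm := by
    rintro ⟨S⟩ ⟨T⟩
    change preHalmosDist μ A S T = preHalmosDist μ A T S
    simp only [preHalmosDist, halmosTerm, symmDiff_comm]
  dist_triangle := by
    rintro ⟨S⟩ ⟨T⟩ ⟨R⟩
    change preHalmosDist μ A S R ≤ preHalmosDist μ A S T + preHalmosDist μ A T R
    unfold preHalmosDist
    rw [← (summable_halmos μ A S T).tsum_add (summable_halmos μ A T R)]
    refine (summable_halmos μ A S R).tsum_le_tsum (fun i => ?_)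
      ((summable_halmos μ A S T).add (summable_halmos μ A T R))
    rw [← mul_add]
    refine mul_le_mul_of_nonneg_left ?_ (by positivity)
    have h1 : μ.real ((S.1 '' A i) ∆ (R.1 '' A i)) ≤
        μ.real ((S.1 '' A i) ∆ (T.1 '' A i)) + μ.real ((T.1 '' A i) ∆ (R.1 '' A i)) :=
      (measureReal_mono (symmDiff_triangle _ _ _)).trans (measureReal_union_le _ _)
    have h2 : μ.real ((S.1 ⁻¹' A i) ∆ (R.1 ⁻¹' A i)) ≤
        μ.real ((S.1 ⁻¹' A i) ∆ (T.1 ⁻¹' A i)) + μ.real ((T.1 ⁻¹' A i) ∆ (R.1 ⁻¹' A i)) :=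
      (measureReal_mono (symmDiff_triangle _ _ _)).trans (measureReal_union_le _ _)
    unfold halmosTerm
    linarith

/-- A property of automorphisms is generic if the set of automorphisms that have it contains
a dense `G_δ` set with respect to the Halmos metric. -/
def IsGenericProperty (μ : Measure X) [IsProbabilityMeasure μ] (A : ℕ → Set X)
    (p : Aut μ → Prop) : Prop :=
  letI : PseudoMetricSpace (Aut μ) := halmosMetric μ A
  ∃ W : Set (Aut μ), IsGδ W ∧ Dense W ∧ ∀ T ∈ W, p T

end Automorphisms

/-! ### Isomorphism of measure-preserving systems -/

/-- `(X, μ, T)` and `(Y, ν, S)` are isomorphic (modulo null sets): `φ` and `ψ` are mutually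
inverse almost everywhere, preserve the measures, and `φ` intertwines `T` and `S`. -/
def IsIsomorphic {X Y : Type*} [MeasurableSpace X] [MeasurableSpace Y]
    (μ : Measure X) (T : X → X) (ν : Measure Y) (S : Y → Y) : Prop :=
  ∃ (φ : X → Y) (ψ : Y → X), MeasurePreserving φ μ ν ∧ MeasurePreserving ψ ν μ ∧
    (∀ᵐ x ∂μ, ψ (φ x) = x) ∧ (∀ᵐ y ∂ν, φ (ψ y) = y) ∧ ∀ᵐ x ∂μ, φ (T x) = S (φ x)

/-! ### Isometric exchanges -/

section Exchanges

/-- A geometric figure in `ℝᵈ`: a bounded set whose boundary has upper box (Minkowski) dimension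
less than `d`, that is, the volume of the `r`-neighbourhood of the boundary is `O(rˢ)`
for some `s > 0`. Polytopes, convex bodies and domains with piecewise smooth
boundary are of this kind. -/
def IsFigure {d : ℕ} (F : Set (EuclideanSpace ℝ (Fin d))) : Prop :=
  Bornology.IsBounded F ∧ ∃ C s : ℝ, 0 < s ∧ ∀ r : ℝ, 0 < r → r ≤ 1 →
    volume (Metric.thickening r (frontier F)) ≤ ENNReal.ofReal (C * r ^ s)

/-- A nondegenerate rectangle (rectangular parallelepiped) in `ℝᵈ` in arbitrary position,
with any part of its boundary included. -/
def IsRectangle {d : ℕ} (F : Set (EuclideanSpace ℝ (Fin d))) : Prop :=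
  ∃ (a b : Fin d → ℝ) (g : EuclideanSpace ℝ (Fin d) ≃ᵢ EuclideanSpace ℝ (Fin d)),
    (∀ k, a k < b k) ∧ g '' {x | ∀ k, a k < x k ∧ x k < b k} ⊆ F ∧
      F ⊆ g '' {x | ∀ k, a k ≤ x k ∧ x k ≤ b k}

/-- An exchange of finitely many subsets of `ℝᵈ` by isometries: the pieces overlap only in null
sets, their images under the isometries overlap only in null sets, and the images
fill up, modulo null sets, the same domain. -/
structure IsometricExchange (d : ℕ) where
  n : ℕ
  piece : Fin n → Set (EuclideanSpace ℝ (Fin d))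
  isom : Fin n → EuclideanSpace ℝ (Fin d) ≃ᵢ EuclideanSpace ℝ (Fin d)
  piece_disjoint : ∀ i j, i ≠ j → volume (piece i ∩ piece j) = 0
  image_disjoint : ∀ i j, i ≠ j → volume ((isom i '' piece i) ∩ (isom j '' piece j)) = 0
  union_image : (⋃ i, isom i '' piece i) =ᵐ[volume] ⋃ i, piece i
  volume_ne_zero : volume (⋃ i, piece i) ≠ 0

namespace IsometricExchange

variable {d : ℕ} (E : IsometricExchange d)

/-- The domain of the exchange. -/
def domain : Set (EuclideanSpace ℝ (Fin d)) := ⋃ i, E.piece i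

/-- Normalized Lebesgue measure on the domain. -/
def measure : Measure (EuclideanSpace ℝ (Fin d)) := ProbabilityTheory.cond volume E.domain

open Classical in
/-- The transformation that acts on each piece by the corresponding isometry. On the null set where
pieces overlap one of the isometries is chosen; outside the domain the value is irrelevant. -/
def map (x : EuclideanSpace ℝ (Fin d)) : EuclideanSpace ℝ (Fin d) :=
  if h : ∃ i, x ∈ E.piece i then E.isom h.choose x else x

/-- All the pieces are geometric figures. -/
def IsFigureExchange : Prop := ∀ i, IsFigure (E.piece i)

/-- All the pieces are rectangles. -/
def IsRectangleExchange : Prop := ∀ i, IsRectangle (E.piece i)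

end IsometricExchange

/-- The automorphism `T` is isomorphic to the exchange `E`. -/
def Aut.IsomorphicToExchange {X : Type*} [MeasurableSpace X] {μ : Measure X} (T : Aut μ)
    {d : ℕ} (E : IsometricExchange d) : Prop :=
  ∃ S : MPEquiv μ, (Quotient.mk (aeSetoid μ) S : Aut μ) = T ∧
    IsIsomorphic μ S.1 E.measure E.map

end Exchanges

end GenericExchange

end

/-! The invariant separating the two classes is a slow-entropy type complexity. Fix `B` of measure
1/2 and compare itineraries with respect to `B`, of length `m ^ 2`, in the normalized Hamming
distance. An automorphism is complex at `m` (`IsComplexAt`) if every Hamming ball of radius 1/8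
contains the itineraries of a set of measure less than `2 ^ -(m + 1)`.

A figure exchange is not complex at any large `m` (`eventually_not_isComplexAt`). Let `r = m ^ -p`
with `p` large. The `r`-neighbourhood of the boundaries has measure `O(m ^ -3)`, so most orbits of
length `m ^ 2` avoid it; two such orbits that start within `r` keep their distance constant.
Polynomially many grid cells, fewer than `2 ^ m`, therefore describe most itineraries up to error
1/8, and some cell must be too large.

Every automorphism `T` is a limit of automorphisms complex at all large `m` (`exists_perturbation`).
Run `T` on all coordinates of a product of copies of `X` and shift the coordinates once every `L`
steps. The itinerary of the coordinate at the origin reads independent points in blocks of length at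
most `L`, so a Chernoff bound gives each Hamming ball measure at most `exp (-n / (8 L))`, which at
`n = m ^ 2` beats `2 ^ -(m + 1)`. The coordinate moves by `T` except on a set of measure `1 / L`,
and an isomorphism respecting a finite partition (`exists_measurableEquiv_levels`) carries the tower
back to `X`, close to `T`.

Complexity at `m` involves finitely many iterates and words, hence is open. Being complex infinitely
often is thus a dense Gδ condition. -/

noncomputable section

namespace GenericExchange

/-! ### Isomorphism of non-atomic standard probability spaces -/

section MeasureIsomorphism

open ProbabilityTheory

/-- The uniform distribution on the unit interval, as a measure on `ℝ`. -/
def uniformMeasure : Measure ℝ := volume.restrict (Icc 0 1)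

instance : IsProbabilityMeasure uniformMeasure :=
  ⟨by simp [uniformMeasure]⟩

instance : NullSingletonClass uniformMeasure := by
  unfold uniformMeasure; infer_instance

theorem uniformMeasure_Iic {t : ℝ} (h1 : t ≤ 1) :
    uniformMeasure (Iic t) = ENNReal.ofReal t := by
  rw [uniformMeasure, Measure.restrict_apply measurableSet_Iic]
  have : Iic t ∩ Icc 0 1 = Icc 0 t := by
    ext x
    simp only [mem_inter_iff, mem_Iic, mem_Icc]
    constructor
    · rintro ⟨a, b, c⟩; exact ⟨b, a⟩
    · rintro ⟨a, b⟩; exact ⟨b, a, b.trans h1⟩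
  rw [this, Real.volume_Icc, sub_zero]

theorem continuous_cdf (m : Measure ℝ) [IsProbabilityMeasure m] [NullSingletonClass m] :
    Continuous (cdf m) := by
  rw [continuous_iff_continuousAt]
  intro a
  rw [(monotone_cdf m).continuousAt_iff_leftLim_eq_rightLim]
  have h : (cdf m).measure {a} = 0 := by rw [measure_cdf]; exact measure_singleton a
  rw [StieltjesFunction.measure_singleton, ENNReal.ofReal_eq_zero, sub_nonpos] at h
  rw [StieltjesFunction.rightLim_eq]
  exact le_antisymm ((monotone_cdf m).leftLim_le le_rfl) h

/-- The probability integral transform. -/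
theorem map_cdf (m : Measure ℝ) [IsProbabilityMeasure m] [NullSingletonClass m] :
    m.map (cdf m) = uniformMeasure := by
  have hmeas : Measurable (cdf m) := (monotone_cdf m).measurable
  have key : ∀ t, 0 < t → t < 1 → ∃ a, cdf m a = t := by
    intro t h0 h1
    obtain ⟨a, ha⟩ := ((tendsto_cdf_atBot m).eventually (gt_mem_nhds h0)).exists
    obtain ⟨b, hb⟩ := ((tendsto_cdf_atTop m).eventually (lt_mem_nhds h1)).exists
    exact mem_range_of_exists_le_of_exists_ge (continuous_cdf m) ⟨a, ha.le⟩ ⟨b, hb.le⟩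
  have hlow : ∀ t, 0 < t → t < 1 → ENNReal.ofReal t ≤ m (cdf m ⁻¹' Iic t) := by
    intro t h0 h1
    obtain ⟨a, rfl⟩ := key t h0 h1
    rw [ofReal_cdf]
    exact measure_mono fun x hx => monotone_cdf m hx
  have hup : ∀ t, 0 < t → t < 1 → m (cdf m ⁻¹' Iio t) ≤ ENNReal.ofReal t := by
    intro t h0 h1
    obtain ⟨a, rfl⟩ := key t h0 h1
    rw [ofReal_cdf]
    exact measure_mono fun x hx => le_of_lt ((monotone_cdf m).reflect_lt hx)
  -- The distribution function may stay constant to the right of `a`, so the closed half-line is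
  -- handled by letting levels `u` decrease to `t` in `hup`.
  have hup' : ∀ t, 0 ≤ t → t < 1 → m (cdf m ⁻¹' Iic t) ≤ ENNReal.ofReal t := by
    intro t h0 h1
    have hlim : Tendsto (fun u : ℝ => ENNReal.ofReal u) (nhdsWithin t (Ioi t))
        (nhds (ENNReal.ofReal t)) :=
      (ENNReal.continuous_ofReal.tendsto t).mono_left nhdsWithin_le_nhds
    refine ge_of_tendsto hlim ?_
    filter_upwards [Ioo_mem_nhdsGT h1] with u hu
    refine le_trans (measure_mono ?_) (hup u (h0.trans_lt hu.1) hu.2)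
    exact preimage_mono (Iic_subset_Iio.2 hu.1)
  have := Measure.isProbabilityMeasure_map (μ := m) hmeas.aemeasurable
  refine Measure.ext_of_Iic _ _ fun t => ?_
  rw [Measure.map_apply hmeas measurableSet_Iic]
  rcases lt_or_ge t 0 with ht | ht
  · have e1 : cdf m ⁻¹' Iic t = ∅ := by
      ext x; simpa using ht.trans_le (cdf_nonneg m x)
    have e2 : uniformMeasure (Iic t) ≤ uniformMeasure (Iic 0) := measure_mono (Iic_subset_Iic.2 ht.le)
    rw [uniformMeasure_Iic zero_le_one] at e2
    rw [e1, measure_empty]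
    exact (le_antisymm (by simpa using e2) bot_le).symm
  rcases lt_or_ge t 1 with ht1 | ht1
  · rw [uniformMeasure_Iic ht1.le]
    refine le_antisymm (hup' t ht ht1) ?_
    rcases ht.eq_or_lt with rfl | ht0
    · simp
    · exact hlow t ht0 ht1
  · have e1 : cdf m ⁻¹' Iic t = univ := by
      ext x; simpa using (cdf_le_one m x).trans ht1
    have e2 : uniformMeasure (Iic 1) ≤ uniformMeasure (Iic t) := measure_mono (Iic_subset_Iic.2 ht1)
    rw [uniformMeasure_Iic le_rfl] at e2
    rw [e1, measure_univ]
    exact le_antisymm (by simpa using e2) prob_le_one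

theorem not_countable_of_nullSingletonClass {X : Type*} [MeasurableSpace X] (μ : Measure X) [IsProbabilityMeasure μ]
    [NullSingletonClass μ] : ¬ Countable X := by
  intro h
  have := (countable_univ (α := X)).measure_zero μ
  simp at this

variable {X : Type*} [MeasurableSpace X] [StandardBorelSpace X]

/-- A non-atomic standard probability space has an uncountable null set. -/
theorem exists_uncountable_null (μ : Measure X) [IsProbabilityMeasure μ] [NullSingletonClass μ] :
    ∃ N : Set X, MeasurableSet N ∧ μ N = 0 ∧ ¬ N.Countable := by
  have hR : ¬ Countable (ℝ × ℝ) := by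
    intro h
    exact not_countable (α := ℝ) (Prod.mk_right_injective (0 : ℝ)).countable
  -- In the plane the vertical lines are uncountably many disjoint uncountable sets; only countably
  -- many can carry positive measure.
  let e : X ≃ᵐ ℝ × ℝ :=
    PolishSpace.measurableEquivOfNotCountable (not_countable_of_nullSingletonClass μ) hR
  let N : ℝ → Set X := fun a => e ⁻¹' (Prod.fst ⁻¹' {a})
  have hN : ∀ a, MeasurableSet (N a) := fun a =>
    e.measurable (measurable_fst (measurableSet_singleton a))
  have hd : Pairwise (Function.onFun Disjoint N) := by
    intro a b hab
    refine Set.disjoint_left.2 fun x hx hx' => hab ?_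
    exact (show (e x).1 = a from hx).symm.trans (show (e x).1 = b from hx')
  have hc := Measure.countable_meas_pos_of_disjoint_iUnion (μ := μ) hN hd
  have : ∃ a, a ∉ {i | 0 < μ (N i)} := by
    by_contra! h
    exact Set.not_countable_univ (α := ℝ) (hc.mono fun x _ => h x)
  obtain ⟨a, ha⟩ := this
  refine ⟨N a, hN a, by simpa using ha, fun h => ?_⟩
  have h2 : (e '' N a).Countable := h.image e
  have h3 : e '' N a = Prod.fst ⁻¹' {a} := by
    rw [image_preimage_eq _ e.surjective]
  rw [h3] at h2
  have h4 : Set.Countable ((Prod.mk a) ⁻¹' (Prod.fst ⁻¹' {a}) : Set ℝ) :=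
    h2.preimage (Prod.mk_right_injective a)
  exact Set.not_countable_univ (α := ℝ) (h4.mono fun x _ => rfl)

/-- A measurable bijection between co-uncountable measurable subsets of standard Borel spaces
extends to the whole spaces. -/
theorem exists_measurableEquiv_extend {Y : Type*} [MeasurableSpace Y] [StandardBorelSpace Y]
    {s : Set X} (hs : MeasurableSet s) (hsc : ¬ sᶜ.Countable) {h : X → Y} (hh : Measurable h)
    (hinj : InjOn h s) (hc : ¬ (h '' s)ᶜ.Countable) :
    ∃ e : X ≃ᵐ Y, ∀ x ∈ s, e x = h x := by
  classical
  have := hs.standardBorel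
  have hemb : MeasurableEmbedding (s.domRestrict h) :=
    Measurable.measurableEmbedding (hh.comp measurable_subtype_coe) (injOn_iff_injective.1 hinj)
  have hr : range (s.domRestrict h) = h '' s := by rw [range_domRestrict]
  have ht : MeasurableSet (range (s.domRestrict h)) := hemb.measurableSet_range
  have := hs.compl.standardBorel
  have := ht.compl.standardBorel
  rw [← hr] at hc
  let e2 : ↥sᶜ ≃ᵐ ↥(range (s.domRestrict h))ᶜ :=
    PolishSpace.measurableEquivOfNotCountable hsc hc
  refine ⟨(MeasurableEquiv.sumCompl hs).symm.trans
    ((hemb.equivRange.sumCongr e2).trans (MeasurableEquiv.sumCompl ht)), fun x hx => ?_⟩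
  have hx' : (MeasurableEquiv.sumCompl hs).symm x = Sum.inl ⟨x, hx⟩ := by
    rw [MeasurableEquiv.symm_apply_eq]
    rfl
  simp only [MeasurableEquiv.trans_apply, hx']
  have : (hemb.equivRange.sumCongr e2) (Sum.inl ⟨x, hx⟩) = Sum.inl (hemb.equivRange ⟨x, hx⟩) := rfl
  rw [this, hemb.equivRange_apply]
  rfl

/-- A non-atomic standard probability space is isomorphic to the unit interval; the isomorphism
can be taken to be the distribution function of any measurable embedding into `ℝ`. -/
theorem exists_measurableEquiv_uniform (μ : Measure X) [IsProbabilityMeasure μ]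
    [NullSingletonClass μ] {g : X → ℝ} (hg : MeasurableEmbedding g) :
    ∃ e : X ≃ᵐ ℝ, MeasurePreserving e μ uniformMeasure ∧
      ∀ᵐ x ∂μ, e x = μ.real {y | g y ≤ g x} := by
  have := Measure.isProbabilityMeasure_map (μ := μ) hg.measurable.aemeasurable
  have : NullSingletonClass (μ.map g) := ⟨fun a => by
    rw [Measure.map_apply hg.measurable (measurableSet_singleton a)]
    exact (subsingleton_singleton.preimage hg.injective).measure_zero μ⟩
  set F := cdf (μ.map g) with hF
  have hFm : Measurable F := (monotone_cdf _).measurable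
  have hH : MeasurePreserving (fun x => F (g x)) μ uniformMeasure :=
    ⟨hFm.comp hg.measurable, by
      rw [← map_cdf (μ.map g), Measure.map_map hFm hg.measurable]; rfl⟩
  obtain ⟨N, hN, hN0, hNc⟩ := exists_uncountable_null μ
  -- `F` fails to be injective only on intervals of constancy. Each contains a rational `q`, so
  -- discarding the countably many levels `F q` restores injectivity at null cost. Removing `N`
  -- makes the complement of `s` uncountable.
  let s : Set X := {x | ∀ q : ℚ, F (g x) ≠ F q} \ N
  have hs1 : ∀ᵐ x ∂μ, ∀ q : ℚ, F (g x) ≠ F q := by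
    rw [ae_all_iff]
    intro q
    have : ∀ᵐ y ∂uniformMeasure, y ≠ F q := by
      simp [ae_iff]
    exact hH.quasiMeasurePreserving.ae this
  have hs2 : ∀ᵐ x ∂μ, x ∈ s := by
    filter_upwards [hs1, measure_eq_zero_iff_ae_notMem.1 hN0] with x h1 h2
    exact ⟨h1, h2⟩
  have hs : MeasurableSet s := by
    refine MeasurableSet.diff ?_ hN
    rw [ofPred_forall]
    refine MeasurableSet.iInter fun q => ?_
    exact (hFm.comp hg.measurable) (measurableSet_singleton (F q)).compl
  have hinj : InjOn (fun x => F (g x)) s := by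
    have hlt : ∀ x ∈ s, ∀ y, g x < g y → F (g x) ≠ F (g y) := by
      intro x hx y hxy h
      obtain ⟨q, h1, h2⟩ := exists_rat_btwn hxy
      refine hx.1 q (le_antisymm (monotone_cdf _ h1.le) ?_)
      rw [h]
      exact monotone_cdf _ h2.le
    intro x hx y hy h
    rcases lt_trichotomy (g x) (g y) with h' | h' | h'
    · exact absurd h (hlt x hx y h')
    · exact hg.injective h'
    · exact absurd h.symm (hlt y hy x h')
  -- The values of `F` are at most 1, so `Ioi 1` is left over; the target is all of `ℝ`, which makes
  -- room for the extension.
  obtain ⟨e, he⟩ := exists_measurableEquiv_extend hs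
    (fun h => hNc (h.mono fun x (hx : x ∈ N) (hx' : x ∈ s) => hx'.2 hx)) hH.measurable hinj (fun h => by
      have h2 : (Ioi (1 : ℝ)).Countable := by
        refine h.mono ?_
        rintro y hy ⟨x, -, rfl⟩
        exact absurd (cdf_le_one _ (g x)) (not_le.2 hy)
      have := h2.measure_zero (volume : Measure ℝ)
      simp at this)
  have hae : ∀ᵐ x ∂μ, e x = F (g x) := hs2.mono he
  refine ⟨e, ⟨e.measurable, ?_⟩, ?_⟩
  · rw [Measure.map_congr hae]; exact hH.map_eq
  · filter_upwards [hae] with x hx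
    rw [hx, hF, cdf_eq_real, map_measureReal_apply hg.measurable measurableSet_Iic]
    rfl

/-- An isomorphism with the unit interval that arranges the level sets of a countable measurable
partition in increasing order. -/
theorem exists_measurableEquiv_uniform_levels (μ : Measure X) [IsProbabilityMeasure μ]
    [NullSingletonClass μ] {f : X → ℕ} (hf : Measurable f) :
    ∃ e : X ≃ᵐ ℝ, MeasurePreserving e μ uniformMeasure ∧
      ∀ᵐ x ∂μ, μ.real {y | f y < f x} ≤ e x ∧ e x ≤ μ.real {y | f y < f x + 1} := by
  -- As `σ` takes values in `(0, 1)`, the embedding `f + σ` orders points by `f` first, and its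
  -- distribution function places each level set in its own interval.
  let σ : X → ℝ := fun x => Real.sigmoid (embeddingReal X x)
  have hσ0 : ∀ x, 0 < σ x := fun x => Real.sigmoid_pos _
  have hσ1 : ∀ x, σ x < 1 := fun x => Real.sigmoid_lt_one _
  have hσi : Function.Injective σ :=
    Real.sigmoid_injective.comp (measurableEmbedding_embeddingReal X).injective
  have hσm : Measurable σ := Real.sigmoid_strictMono.monotone.measurable.comp (measurable_embeddingReal X)
  have hle : ∀ x y, (f x : ℝ) + σ x ≤ f y + σ y → f x ≤ f y := by
    intro x y h
    by_contra! h'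
    have : (f y : ℝ) + 1 ≤ f x := by exact_mod_cast h'
    linarith [hσ0 x, hσ1 y]
  have hg : MeasurableEmbedding fun x => (f x : ℝ) + σ x := by
    refine Measurable.measurableEmbedding ?_ ?_
    · exact (measurable_from_top.comp hf).add hσm
    · intro x y h
      have h1 : f x = f y := le_antisymm (hle x y h.le) (hle y x h.ge)
      simp only [h1, add_right_inj] at h
      exact hσi h
  obtain ⟨e, he, hae⟩ := exists_measurableEquiv_uniform μ hg
  refine ⟨e, he, ?_⟩
  filter_upwards [hae] with x hx
  rw [hx]
  refine ⟨measureReal_mono fun y (hy : f y < f x) => ?_, measureReal_mono fun y hy => ?_⟩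
  · by_contra hlt
    have : (f x : ℝ) + σ x ≤ f y + σ y := le_of_lt (not_le.1 hlt)
    exact absurd (hle x y this) (not_le.2 hy)
  · exact Nat.lt_succ_of_le (hle y x hy)

/-- Two non-atomic standard probability spaces are isomorphic by a map that respects given
countable measurable partitions with the same distribution. -/
theorem exists_measurableEquiv_levels {Y : Type*} [MeasurableSpace Y] [StandardBorelSpace Y]
    (μ : Measure X) [IsProbabilityMeasure μ] [NullSingletonClass μ]
    (ν : Measure Y) [IsProbabilityMeasure ν] [NullSingletonClass ν]
    {f : X → ℕ} (hf : Measurable f) {g : Y → ℕ} (hg : Measurable g)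
    (hfg : μ.map f = ν.map g) :
    ∃ θ : X ≃ᵐ Y, MeasurePreserving θ μ ν ∧ ∀ᵐ x ∂μ, g (θ x) = f x := by
  obtain ⟨e, he, hae⟩ := exists_measurableEquiv_uniform_levels μ hf
  obtain ⟨e', he', hae'⟩ := exists_measurableEquiv_uniform_levels ν hg
  have hs : ∀ k, ν.real {y | g y < k} = μ.real {x | f x < k} := by
    intro k
    have h1 := map_measureReal_apply (μ := μ) hf (s := Iio k) (measurableSet_Iio)
    have h2 := map_measureReal_apply (μ := ν) hg (s := Iio k) (measurableSet_Iio)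
    rw [hfg] at h1
    exact h2.symm.trans h1
  have hθ : MeasurePreserving (e.trans e'.symm) μ ν := (he'.symm e').comp he
  refine ⟨e.trans e'.symm, hθ, ?_⟩
  -- Level intervals meet only at their endpoints; discarding these countably many values makes the
  -- level unambiguous.
  have hne : ∀ᵐ x ∂μ, ∀ k : ℕ, e x ≠ μ.real {y | f y < k} := by
    rw [ae_all_iff]
    intro k
    have : ∀ᵐ y ∂uniformMeasure, y ≠ μ.real {y | f y < k} := by simp [ae_iff]
    exact he.quasiMeasurePreserving.ae this
  filter_upwards [hae, hθ.quasiMeasurePreserving.ae hae', hne] with x h1 h2 h3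
  simp only [MeasurableEquiv.trans_apply, MeasurableEquiv.apply_symm_apply, hs] at h2 ⊢
  have hmono : ∀ k l : ℕ, k ≤ l → μ.real {y | f y < k} ≤ μ.real {y | f y < l} := fun k l hkl =>
    measureReal_mono fun y (hy : f y < k) => hy.trans_le hkl
  set j := g (e'.symm (e x)) with hj
  rcases lt_trichotomy j (f x) with h | h | h
  · exact absurd (le_antisymm (h2.2.trans (hmono _ _ h)) h1.1) (h3 _)
  · exact h
  · exact absurd (le_antisymm (h1.2.trans (hmono _ _ h)) h2.1) (h3 _)

/-- A non-atomic standard probability space has a measurable set of measure one half. -/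
theorem exists_measure_eq_half (μ : Measure X) [IsProbabilityMeasure μ] [NullSingletonClass μ] :
    ∃ B : Set X, MeasurableSet B ∧ μ.real B = 1 / 2 := by
  obtain ⟨e, he, -⟩ := exists_measurableEquiv_uniform μ (measurableEmbedding_embeddingReal X)
  refine ⟨e ⁻¹' Iic (1 / 2), e.measurable measurableSet_Iic, ?_⟩
  rw [measureReal_def, he.measure_preimage measurableSet_Iic.nullMeasurableSet,
    uniformMeasure_Iic (by norm_num), ENNReal.toReal_ofReal (by norm_num)]

end MeasureIsomorphism

/-! ### Hamming distance of itineraries -/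

section Itineraries

variable {X : Type*}

open Classical in
/-- The number of times `k < n` at which the itinerary of `x` with respect to `B` differs from the
word `w`. -/
def mismatch (T : X → X) (B : Set X) {n : ℕ} (w : Set (Fin n)) (x : X) : ℕ :=
  (Finset.univ.filter fun k : Fin n => ¬ (T^[k] x ∈ B ↔ k ∈ w)).card

theorem mismatch_congr {Y : Type*} {T : X → X} {S : Y → Y} {B : Set X} {C : Set Y} {n : ℕ}
    (w : Set (Fin n)) {x : X} {y : Y} (h : ∀ k : Fin n, T^[k] x ∈ B ↔ S^[k] y ∈ C) :
    mismatch T B w x = mismatch S C w y := by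
  classical
  unfold mismatch
  exact congrArg Finset.card (Finset.filter_congr fun k _ => by rw [h k])

variable [MeasurableSpace X]

/-- A linear upper bound, so that the Laplace transform of a variable with values in `[0, 1]` is
controlled by its mean alone. -/
theorem exp_neg_le_one_sub_half {t : ℝ} (h0 : 0 ≤ t) (h1 : t ≤ 1) :
    Real.exp (-t) ≤ 1 - t / 2 := by
  have h := Real.add_one_le_exp t
  have hpos : 0 < 1 + t := by linarith
  rw [Real.exp_neg]
  calc (Real.exp t)⁻¹ ≤ (1 + t)⁻¹ := inv_anti₀ hpos (by linarith)
    _ ≤ 1 - t / 2 := by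
      rw [inv_le_iff_one_le_mul₀ hpos]
      nlinarith

open Classical in
/-- Exponential estimate for the probability that a fixed word is well approximated, for the
itinerary that reads off independent orbits, each of them at most `L` times. -/
theorem measure_card_le_le_exp {ι : Type*} [Fintype ι] {μ : Measure X} [IsProbabilityMeasure μ]
    {n L : ℕ} (hL : 0 < L) (D : Fin n → Set X) (hD : ∀ k, MeasurableSet (D k))
    (hD2 : ∀ k, μ.real (D k) = 1 / 2) (idx : Fin n → ι)
    (hidx : ∀ i, (Finset.univ.filter fun k => idx k = i).card ≤ L) :
    (Measure.pi fun _ : ι => μ).real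
      {x | 8 * (Finset.univ.filter fun k => x (idx k) ∈ D k).card ≤ n} ≤
      Real.exp (-(n / (8 * L))) := by
  have hL' : (0 : ℝ) < L := by exact_mod_cast hL
  let N : ι → ℕ := fun i => (Finset.univ.filter fun k => idx k = i).card
  -- The count splits into the contributions `h i (x i)` of the coordinates, which are independent
  -- with values in `[0, L]` and mean `N i / 2`.
  let h : ι → X → ℝ := fun i y =>
    ∑ k ∈ Finset.univ.filter fun k => idx k = i, (D k).indicator (fun _ => (1 : ℝ)) y
  have hhm : ∀ i, Measurable (h i) := fun i =>
    Finset.measurable_sum _ fun k _ => measurable_const.indicator (hD k)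
  have hh0 : ∀ i y, 0 ≤ h i y := fun i y =>
    Finset.sum_nonneg fun k _ => indicator_nonneg (fun _ _ => zero_le_one) _
  have hhL : ∀ i y, h i y ≤ L := by
    intro i y
    calc h i y ≤ ∑ k ∈ Finset.univ.filter fun k => idx k = i, (1 : ℝ) :=
          Finset.sum_le_sum fun k _ => indicator_le_self' (fun _ _ => zero_le_one) _
      _ = N i := by simp [N]
      _ ≤ L := by exact_mod_cast hidx i
  have hind : ∀ k, Integrable ((D k).indicator fun _ => (1 : ℝ)) μ := fun k =>
    (integrable_const 1).indicator (hD k)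
  have hhi : ∀ i, Integrable (h i) μ := fun i => integrable_finsetSum _ fun k _ => hind k
  have hint : ∀ i, ∫ y, h i y ∂μ = N i / 2 := by
    intro i
    rw [integral_finsetSum _ fun k _ => hind k]
    simp_rw [integral_indicator_const _ (hD _), hD2]
    simp [N, div_eq_mul_inv]
  have hexp : ∀ i, ∫ y, Real.exp (-(h i y / L)) ∂μ ≤ Real.exp (-(N i / (4 * L))) := by
    intro i
    have hi2 : Integrable (fun y => 1 - h i y / L / 2) μ :=
      (integrable_const 1).sub (((hhi i).div_const _).div_const _)
    calc ∫ y, Real.exp (-(h i y / L)) ∂μ ≤ ∫ y, (1 - h i y / L / 2) ∂μ := by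
          refine integral_mono_of_nonneg (Eventually.of_forall fun y => (Real.exp_pos _).le) hi2
            (Eventually.of_forall fun y => ?_)
          exact exp_neg_le_one_sub_half (div_nonneg (hh0 i y) hL'.le)
            ((div_le_one hL').2 (hhL i y))
      _ = 1 - N i / (4 * L) := by
          rw [integral_sub (integrable_const 1) (((hhi i).div_const _).div_const _)]
          simp_rw [integral_div, hint]
          simp
          field_simp
          norm_num
      _ ≤ Real.exp (-(N i / (4 * L))) := by
          have := Real.add_one_le_exp (-((N i : ℝ) / (4 * L)))
          linarith
  have hsumN : ∑ i, (N i : ℝ) = n := by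
    have := Finset.card_eq_sum_card_fiberwise (s := (Finset.univ : Finset (Fin n)))
      (t := (Finset.univ : Finset ι)) (f := idx) (fun _ _ => by simp)
    rw [Finset.card_univ, Fintype.card_fin] at this
    exact_mod_cast this.symm
  have hcard : ∀ x : ι → X, ((Finset.univ.filter fun k => x (idx k) ∈ D k).card : ℝ) =
      ∑ i, h i (x i) := by
    intro x
    have h1 : ∀ i, h i (x i) = ∑ k ∈ Finset.univ.filter fun k => idx k = i,
        (D k).indicator (fun _ => (1 : ℝ)) (x (idx k)) := fun i =>
      Finset.sum_congr rfl fun k hk => by rw [(Finset.mem_filter.1 hk).2]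
    simp_rw [h1]
    have h2 := Finset.sum_fiberwise Finset.univ idx
      fun k => (D k).indicator (fun _ => (1 : ℝ)) (x (idx k))
    rw [Finset.card_filter]
    push_cast
    convert h2.symm using 1
    exact Finset.sum_congr rfl fun k _ => by simp [indicator_apply]
  let Φ : (ι → X) → ℝ := fun x => ∏ i, Real.exp (-(h i (x i) / L))
  have hΦ : ∫ x, Φ x ∂(Measure.pi fun _ : ι => μ) ≤ Real.exp (-(n / (4 * L))) := by
    rw [integral_fintype_prod_eq_prod (fun i y => Real.exp (-(h i y / L)))]
    calc ∏ i, ∫ y, Real.exp (-(h i y / L)) ∂μ ≤ ∏ i, Real.exp (-(N i / (4 * L))) :=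
          Finset.prod_le_prod (fun i _ => integral_nonneg fun y => (Real.exp_pos _).le)
            fun i _ => hexp i
      _ = Real.exp (-(n / (4 * L))) := by
          rw [← Real.exp_sum, Finset.sum_neg_distrib, ← Finset.sum_div, hsumN]
  have hΦi : Integrable Φ (Measure.pi fun _ : ι => μ) := by
    refine Integrable.of_bound (C := 1) ?_ (Eventually.of_forall fun x => ?_)
    · refine Measurable.aestronglyMeasurable (Finset.measurable_prod _ fun i _ => ?_)
      exact Real.measurable_exp.comp (((hhm i).comp (measurable_pi_apply i)).div_const _).neg
    · rw [Real.norm_of_nonneg (Finset.prod_nonneg fun i _ => (Real.exp_pos _).le)]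
      refine Finset.prod_le_one (fun i _ => (Real.exp_pos _).le) fun i _ => ?_
      rw [Real.exp_le_one_iff, neg_nonpos]
      exact div_nonneg (hh0 i _) hL'.le
  -- Chernoff: on the event `Φ` is at least `exp (-n / (8 L))`, while its integral is at most the
  -- square of this number.
  have hmarkov := mul_meas_ge_le_integral_of_nonneg
    (Eventually.of_forall fun x => Finset.prod_nonneg fun i _ => (Real.exp_pos _).le) hΦi
    (Real.exp (-(n / (8 * L))))
  have hsub : {x : ι → X | 8 * (Finset.univ.filter fun k => x (idx k) ∈ D k).card ≤ n} ⊆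
      {x | Real.exp (-(n / (8 * L))) ≤ Φ x} := by
    intro x hx
    have hx' : 8 * ∑ i, h i (x i) ≤ n := by
      rw [← hcard]; exact_mod_cast hx
    change Real.exp _ ≤ ∏ i, Real.exp _
    rw [← Real.exp_sum, Real.exp_le_exp, Finset.sum_neg_distrib, ← Finset.sum_div, neg_le_neg_iff,
      div_le_div_iff₀ hL' (by positivity)]
    nlinarith
  have hfin : Real.exp (-(n / (8 * L))) * (Measure.pi fun _ : ι => μ).real
      {x | 8 * (Finset.univ.filter fun k => x (idx k) ∈ D k).card ≤ n} ≤
      Real.exp (-(n / (8 * L))) * Real.exp (-(n / (8 * L))) := by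
    rw [← Real.exp_add]
    have e : (-((n : ℝ) / (8 * L)) + -(n / (8 * L))) = -(n / (4 * L)) := by
      field_simp
      ring
    rw [e]
    refine le_trans (mul_le_mul_of_nonneg_left (measureReal_mono hsub) (Real.exp_pos _).le) ?_
    exact hmarkov.trans hΦ
  exact le_of_mul_le_mul_left hfin (Real.exp_pos _)

-- The event depends only on the finitely many coordinates in the range of `idx`, so it can be
-- measured in a finite product.
open Classical in
theorem measure_infinitePi_card_le_le_exp {ι : Type*} {μ : Measure X} [IsProbabilityMeasure μ]
    {n L : ℕ} (hL : 0 < L) (D : Fin n → Set X) (hD : ∀ k, MeasurableSet (D k))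
    (hD2 : ∀ k, μ.real (D k) = 1 / 2) (idx : Fin n → ι)
    (hidx : ∀ i, (Finset.univ.filter fun k => idx k = i).card ≤ L) :
    (Measure.infinitePi fun _ : ι => μ)
      {x | 8 * (Finset.univ.filter fun k => x (idx k) ∈ D k).card ≤ n} ≤
      ENNReal.ofReal (Real.exp (-(n / (8 * L)))) := by
  let s : Finset ι := Finset.univ.image idx
  let idx' : Fin n → s := fun k => ⟨idx k, Finset.mem_image_of_mem _ (Finset.mem_univ k)⟩
  have h := measure_card_le_le_exp hL D hD hD2 idx' fun i => by
    refine le_trans (le_of_eq ?_) (hidx i)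
    congr 1
    ext k
    simp [idx', Subtype.ext_iff]
  rw [measureReal_def] at h
  refine le_trans ?_ ((ENNReal.le_ofReal_iff_toReal_le (measure_ne_top _ _)
    (Real.exp_pos _).le).2 h)
  have hmap := Measure.infinitePi_map_restrict (fun _ : ι => μ) (I := s)
  rw [← hmap]
  exact Measure.le_map_apply (μ := Measure.infinitePi fun _ : ι => μ)
    (f := s.restrict (π := fun _ => X)) (Finset.measurable_restrict s).aemeasurable
    {x : s → X | 8 * (Finset.univ.filter fun k => x (idx' k) ∈ D k).card ≤ n}

end Itineraries

/-! ### Perturbation by a tower over a Bernoulli scheme -/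

section Tower

variable {X : Type*} [MeasurableSpace X]

/-- The index shift, performed when the clock strikes. -/
def towerShift {L : ℕ} (c : ZMod L) : ℤ := if c + 1 = 0 then 1 else 0

/-- The tower of height `L`: the clock runs cyclically, `T` acts on all the coordinates, and the
coordinates are shifted when the clock strikes. -/
def tower (T : X ≃ᵐ X) (L : ℕ) [NeZero L] :
    ZMod L × (ℤ → X) ≃ᵐ ZMod L × (ℤ → X) where
  toFun z := (z.1 + 1, fun i => T (z.2 (i + towerShift z.1)))
  invFun z := (z.1 - 1, fun i => T.symm (z.2 (i - towerShift (z.1 - 1))))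
  left_inv z := by ext <;> simp
  right_inv z := by ext <;> simp
  measurable_toFun := by
    refine Measurable.prodMk ?_ (measurable_pi_iff.2 fun i => ?_)
    · exact (measurable_of_countable fun c : ZMod L => c + 1).comp measurable_fst
    · refine measurable_from_prod_countable_right fun c => ?_
      exact T.measurable.comp (measurable_pi_apply (i + towerShift c))
  measurable_invFun := by
    refine Measurable.prodMk ?_ (measurable_pi_iff.2 fun i => ?_)
    · exact (measurable_of_countable fun c : ZMod L => c - 1).comp measurable_fst
    · refine measurable_from_prod_countable_right fun c => ?_
      exact T.symm.measurable.comp (measurable_pi_apply (i - towerShift (c - 1)))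

theorem tower_apply (T : X ≃ᵐ X) (L : ℕ) [NeZero L] (z : ZMod L × (ℤ → X)) :
    tower T L z = (z.1 + 1, fun i => T (z.2 (i + towerShift z.1))) := rfl

/-- By time `k` the clock, started at `c`, has struck `(c + k) / L` times. The origin therefore
reads successive independent coordinates, each for at most `L` consecutive times. -/
theorem tower_iterate (T : X ≃ᵐ X) (L : ℕ) [NeZero L] (z : ZMod L × (ℤ → X)) (k : ℕ) :
    (tower T L)^[k] z =
      (z.1 + k, fun i => T^[k] (z.2 (i + (((z.1.val + k) / L : ℕ) : ℤ)))) := by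
  induction k with
  | zero =>
    have : z.1.val / L = 0 := Nat.div_eq_of_lt (ZMod.val_lt z.1)
    simp [this]
  | succ k ih =>
    rw [Function.iterate_succ_apply', ih, tower_apply]
    have hs : towerShift (z.1 + (k : ZMod L)) + (((z.1.val + k) / L : ℕ) : ℤ) =
        (((z.1.val + (k + 1)) / L : ℕ) : ℤ) := by
      rw [← add_assoc, Nat.succ_div, towerShift, add_comm]
      have : (z.1 + (k : ZMod L) + 1 = 0) ↔ L ∣ z.1.val + k + 1 := by
        rw [← ZMod.natCast_eq_zero_iff]
        push_cast
        rw [ZMod.natCast_zmod_val]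
      by_cases h : L ∣ z.1.val + k + 1
      · simp [this, h]
      · simp [this, h]
    refine Prod.ext ?_ (funext fun i => ?_)
    · push_cast; ring
    · simp only
      rw [Function.iterate_succ_apply', add_assoc, hs]

/-- The invariant measure of the tower. -/
def towerMeasure (μ : Measure X) (L : ℕ) [NeZero L] :
    Measure (ZMod L × (ℤ → X)) :=
  (ProbabilityTheory.uniformOn univ).prod (Measure.infinitePi fun _ => μ)

variable (μ : Measure X) [IsProbabilityMeasure μ] (L : ℕ) [NeZero L]

instance : IsProbabilityMeasure (ProbabilityTheory.uniformOn (univ : Set (ZMod L))) :=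
  ProbabilityTheory.isProbabilityMeasure_uniformOn finite_univ univ_nonempty

instance : IsProbabilityMeasure (towerMeasure μ L) := by
  unfold towerMeasure; infer_instance

theorem measurePreserving_comp_equiv {ι : Type*} (e : ι ≃ ι) :
    MeasurePreserving (fun (x : ι → X) i => x (e i)) (Measure.infinitePi fun _ => μ)
      (Measure.infinitePi fun _ => μ) := by
  refine ⟨measurable_pi_iff.2 fun i => measurable_pi_apply _, ?_⟩
  have h := Measure.infinitePi_map_piCongrLeft (fun _ : ι => μ) e.symm
  convert h using 2
  ext x i
  have := Equiv.piCongrLeft_apply_apply (fun _ => X) e.symm x (e i)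
  rw [e.symm_apply_apply] at this
  exact this.symm

theorem measurePreserving_infinitePi {ι : Type*} {T : X → X} (hT : MeasurePreserving T μ μ) :
    MeasurePreserving (fun (x : ι → X) i => T (x i)) (Measure.infinitePi fun _ => μ)
      (Measure.infinitePi fun _ => μ) := by
  refine ⟨measurable_pi_iff.2 fun i => hT.measurable.comp (measurable_pi_apply _), ?_⟩
  have := Measure.infinitePi_map_pi (fun _ : ι => μ) (f := fun _ => T) fun _ => hT.measurable
  rw [this]
  simp_rw [hT.map_eq]

/-- The tower is a skew product over the rotation of `ZMod L`; each fibre map permutes the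
coordinates and applies `T` to all of them. -/
theorem measurePreserving_tower {T : X ≃ᵐ X} (hT : MeasurePreserving T μ μ) :
    MeasurePreserving (tower T L) (towerMeasure μ L) (towerMeasure μ L) := by
  refine MeasurePreserving.skew_product (f := fun c : ZMod L => c + 1)
    (g := fun c (x : ℤ → X) i => T (x (i + towerShift c))) ⟨measurable_of_countable _, ?_⟩ ?_ ?_
  · ext s hs
    rw [Measure.map_apply (measurable_of_countable _) hs, ProbabilityTheory.uniformOn_univ,
      ProbabilityTheory.uniformOn_univ]
    congr 1
    exact (Measure.count_injective_image (f := fun c : ZMod L => c + 1) (add_left_injective 1) _).symm.trans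
      (by rw [image_preimage_eq _ (add_right_surjective 1)])
  · refine measurable_from_prod_countable_right fun c => measurable_pi_iff.2 fun i => ?_
    exact T.measurable.comp (measurable_pi_apply (i + towerShift c))
  · refine Eventually.of_forall fun c => ?_
    exact ((measurePreserving_infinitePi μ hT).comp
      (measurePreserving_comp_equiv μ (Equiv.addRight (towerShift c)))).map_eq

/-- The factor map of the tower that reads the coordinate at the origin. -/
def towerProj (z : ZMod L × (ℤ → X)) : X := z.2 0

theorem measurePreserving_towerProj :
    MeasurePreserving (towerProj L) (towerMeasure μ L) μ :=
  (measurePreserving_eval_infinitePi (fun _ : ℤ => μ) 0).comp measurePreserving_snd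

instance [NullSingletonClass μ] : NullSingletonClass (towerMeasure μ L) :=
  ⟨fun z => measure_mono_null (t := towerProj L ⁻¹' {towerProj L z}) (by simp)
    ((measurePreserving_towerProj μ L).quasiMeasurePreserving.preimage_null
      (measure_singleton _))⟩

/-- Away from this event `towerProj` intertwines the tower with `T`, so its measure bounds the size
of the perturbation. -/
theorem towerMeasure_strike :
    (towerMeasure μ L).real {z | z.1 + 1 = 0} = 1 / L := by
  have : {z : ZMod L × (ℤ → X) | z.1 + 1 = 0} = ({-1} : Set (ZMod L)) ×ˢ univ := by
    ext z; simp [eq_neg_iff_add_eq_zero]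
  rw [this, towerMeasure, measureReal_prod_prod, probReal_univ, mul_one, measureReal_def,
    ProbabilityTheory.uniformOn_univ, Measure.count_singleton, ZMod.card]
  simp

open Classical in
theorem card_block_le (L : ℕ) [NeZero L] {n : ℕ} (c : ZMod L) (i : ℤ) :
    (Finset.univ.filter fun k : Fin n => (((c.val + k) / L : ℕ) : ℤ) = i).card ≤ L := by
  have hL : 0 < L := Nat.pos_of_ne_zero (NeZero.ne L)
  calc (Finset.univ.filter fun k : Fin n => (((c.val + k) / L : ℕ) : ℤ) = i).card
      ≤ (Finset.Ico (i.toNat * L) (i.toNat * L + L)).card := by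
        refine Finset.card_le_card_of_injOn (fun k : Fin n => c.val + k) ?_ ?_
        · intro k hk
          have h : (c.val + k) / L = i.toNat := by
            rw [← (Finset.mem_filter.1 hk).2, Int.toNat_natCast]
          have h1 := Nat.div_mul_le_self (c.val + k) L
          have h2 := Nat.lt_div_mul_add (a := c.val + k) hL
          rw [h] at h1 h2
          simpa using ⟨h1, h2⟩
        · intro k _ l _ h
          exact Fin.ext (Nat.add_left_cancel h)
    _ = L := by simp

open Classical in
/-- In the tower no word is a good approximation to more than an exponentially small proportion
of the itineraries. -/
theorem measure_tower_mismatch {T : X ≃ᵐ X} (hT : MeasurePreserving T μ μ) {B : Set X}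
    (hB : MeasurableSet B) (hB2 : μ.real B = 1 / 2) {n : ℕ} (w : Set (Fin n)) :
    (towerMeasure μ L) {z | 8 * mismatch (tower T L) (towerProj L ⁻¹' B) w z ≤ n} ≤
      ENNReal.ofReal (Real.exp (-(n / (8 * L)))) := by
  have hL : 0 < L := Nat.pos_of_ne_zero (NeZero.ne L)
  -- Each mismatch event is a preimage of `B` or its complement; since `B` has measure 1/2, so does
  -- `D k`, whatever the word.
  let D : Fin n → Set X := fun k => {y | ¬ (T^[k] y ∈ B ↔ k ∈ w)}
  have hTk : ∀ k : ℕ, MeasurePreserving (T^[k]) μ μ := fun k => hT.iterate k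
  have hpre : ∀ k : ℕ, μ.real (T^[k] ⁻¹' B) = 1 / 2 := fun k => by
    rw [(hTk k).measureReal_preimage hB.nullMeasurableSet, hB2]
  have hDeq : ∀ k : Fin n, D k = T^[k] ⁻¹' B ∨ D k = (T^[k] ⁻¹' B)ᶜ := by
    intro k
    by_cases hk : k ∈ w
    · right; ext y; simp [D, hk]
    · left; ext y; simp [D, hk]
  have hpm : ∀ k : ℕ, MeasurableSet (T^[k] ⁻¹' B) := fun k => (hTk k).measurable hB
  have hD : ∀ k, MeasurableSet (D k) := by
    intro k
    rcases hDeq k with h | h <;> rw [h]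
    · exact hpm k
    · exact (hpm k).compl
  have hD2 : ∀ k, μ.real (D k) = 1 / 2 := by
    intro k
    rcases hDeq k with h | h <;> rw [h]
    · exact hpre k
    · rw [probReal_compl_eq_one_sub (hpm k), hpre k]; norm_num
  have hcount : ∀ c x, mismatch (tower T L) (towerProj L ⁻¹' B) w (c, x) =
      (Finset.univ.filter fun k : Fin n => x (((c.val + k) / L : ℕ) : ℤ) ∈ D k).card := by
    intro c x
    unfold mismatch
    congr 1
    refine Finset.filter_congr fun k _ => ?_
    rw [tower_iterate]
    simp [D, towerProj]
  have hmeas : MeasurableSet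
      {z | 8 * mismatch (tower T L) (towerProj L ⁻¹' B) w z ≤ n} := by
    have : Measurable fun z => 8 * mismatch (tower T L) (towerProj L ⁻¹' B) w z := by
      refine measurable_from_prod_countable_right fun c => ?_
      simp_rw [hcount, Finset.card_filter]
      refine (Finset.measurable_sum _ fun k _ => ?_).const_mul 8
      exact Measurable.ite (measurable_pi_apply _ (hD k)) measurable_const measurable_const
    exact this measurableSet_Iic
  rw [towerMeasure, Measure.prod_apply hmeas]
  calc _ ≤ ∫⁻ _ : ZMod L, ENNReal.ofReal (Real.exp (-(n / (8 * L))))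
        ∂(ProbabilityTheory.uniformOn univ) := by
        refine lintegral_mono fun c => ?_
        have h := measure_infinitePi_card_le_le_exp (μ := μ) hL D hD hD2
          (fun k : Fin n => (((c.val + k) / L : ℕ) : ℤ))
          (fun i => by convert card_block_le L c i)
        refine le_trans (le_of_eq ?_) h
        congr 1
        ext x
        simp only [mem_preimage, mem_ofPred_eq, hcount]
        congr!
    _ = _ := by simp

end Tower

/-! ### Transfer of the tower to the given space -/

section Perturbation

variable {X : Type*} [MeasurableSpace X]

/-- A finite family of measurable sets is encoded by a measurable function to `ℕ`. -/
theorem exists_measurable_code {ι : Type*} [Finite ι] (D : ι → Set X)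
    (hD : ∀ i, MeasurableSet (D i)) :
    ∃ f : X → ℕ, Measurable f ∧ ∀ x y, f x = f y → ∀ i, x ∈ D i ↔ y ∈ D i := by
  refine ⟨fun x => (Finite.equivFin (Set ι) {i | x ∈ D i} : ℕ), ?_, fun x y h i => ?_⟩
  · have h1 : Measurable fun x => ({i | x ∈ D i} : Set ι) :=
      measurable_set_iff.2 fun i => measurable_mem.2 (hD i)
    exact (measurable_of_countable fun s : Set ι => (Finite.equivFin (Set ι) s : ℕ)).comp h1
  · have h1 : ({i | x ∈ D i} : Set ι) = {i | y ∈ D i} :=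
      (Finite.equivFin (Set ι)).injective (Fin.ext h)
    exact Set.ext_iff.1 h1 i

variable [StandardBorelSpace X] {μ : Measure X} [IsProbabilityMeasure μ] [NullSingletonClass μ]

open Classical in
/-- Every automorphism has arbitrarily small perturbations whose itineraries with respect to a
given set of measure one half are exponentially hard to approximate. -/
theorem exists_perturbation (T : MPEquiv μ) {B : Set X} (hB : MeasurableSet B)
    (hB2 : μ.real B = 1 / 2) {ι : Type*} [Finite ι] (C : ι → Set X)
    (hC : ∀ j, MeasurableSet (C j)) (L : ℕ) [NeZero L] :
    ∃ S : MPEquiv μ, (∀ j, μ.real ((S.1 ⁻¹' C j) ∆ (T.1 ⁻¹' C j)) ≤ 1 / L) ∧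
      ∀ (n : ℕ) (w : Set (Fin n)), μ.real {x | 8 * mismatch S.1 B w x ≤ n} ≤
        Real.exp (-(n / (8 * L))) := by
  -- The sets that the isomorphism must respect: `B` to transport itineraries, and `C j` with `T ⁻¹'
  -- C j` to compare `S` with `T`.
  let D : Option (ι ⊕ ι) → Set X := fun o => match o with
    | none => B
    | some (Sum.inl j) => C j
    | some (Sum.inr j) => T.1 ⁻¹' C j
  have hD : ∀ o, MeasurableSet (D o) := by
    rintro (_ | j | j)
    · exact hB
    · exact hC j
    · exact T.1.measurable (hC j)
  obtain ⟨f, hf, hfD⟩ := exists_measurable_code D hD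
  have hp := measurePreserving_towerProj μ L
  obtain ⟨θ, hθ, hθf⟩ := exists_measurableEquiv_levels μ (towerMeasure μ L) hf
    (hf.comp hp.measurable) (by rw [← Measure.map_map hf hp.measurable, hp.map_eq])
  have hθD : ∀ o, ∀ᵐ x ∂μ, towerProj L (θ x) ∈ D o ↔ x ∈ D o := fun o => by
    filter_upwards [hθf] with x hx
    exact hfD _ _ hx o
  let τ := tower T.1 L
  have hτ : MeasurePreserving τ _ _ := measurePreserving_tower μ L T.2
  let S : MPEquiv μ := ⟨θ.trans (τ.trans θ.symm), (hθ.symm θ).comp (hτ.comp hθ)⟩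
  have hS : ∀ x, θ (S.1 x) = τ (θ x) := fun x => θ.apply_symm_apply _
  have hSk : ∀ k x, θ (S.1^[k] x) = τ^[k] (θ x) := by
    intro k x
    exact (Function.Semiconj.iterate_right (f := θ) hS k) x
  refine ⟨S, fun j => ?_, fun n w => ?_⟩
  · have hsub : ((S.1 ⁻¹' C j) ∆ (T.1 ⁻¹' C j) : Set X) ≤ᵐ[μ] θ ⁻¹' {z | z.1 + 1 = 0} := by
      filter_upwards [S.2.quasiMeasurePreserving.ae (hθD (some (Sum.inl j))),
        hθD (some (Sum.inr j))] with x h1 h2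
      refine fun hx => ?_
      by_contra hne
      have hne' : (θ x).1 + 1 ≠ 0 := hne
      have h3 : towerProj L (θ (S.1 x)) = T.1 (towerProj L (θ x)) := by
        rw [hS]
        simp [τ, tower_apply, towerProj, towerShift, hne']
      have h4 : S.1 x ∈ C j ↔ T.1 x ∈ C j := by
        rw [h3] at h1
        exact h1.symm.trans h2
      rcases hx with hx | hx
      · exact hx.2 (h4.1 hx.1)
      · exact hx.2 (h4.2 hx.1)
    have hm : MeasurableSet {z : ZMod L × (ℤ → X) | z.1 + 1 = 0} :=
      ((measurable_of_countable fun c : ZMod L => c + 1).comp measurable_fst)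
        (measurableSet_singleton 0)
    calc μ.real ((S.1 ⁻¹' C j) ∆ (T.1 ⁻¹' C j)) ≤ μ.real (θ ⁻¹' {z | z.1 + 1 = 0}) :=
          ENNReal.toReal_mono (measure_ne_top _ _) (measure_mono_ae hsub)
      _ = 1 / L := by
          rw [hθ.measureReal_preimage hm.nullMeasurableSet, towerMeasure_strike]
  · have hall : ∀ᵐ x ∂μ, ∀ k : ℕ, S.1^[k] x ∈ B ↔ τ^[k] (θ x) ∈ towerProj L ⁻¹' B := by
      rw [ae_all_iff]
      intro k
      filter_upwards [(S.2.iterate k).quasiMeasurePreserving.ae (hθD none)] with x hx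
      rw [hSk] at hx
      exact hx.symm
    have heq : ({x | 8 * mismatch S.1 B w x ≤ n} : Set X) =ᵐ[μ]
        θ ⁻¹' {z | 8 * mismatch τ (towerProj L ⁻¹' B) w z ≤ n} := by
      filter_upwards [hall] with x hx
      refine propext ?_
      change 8 * mismatch S.1 B w x ≤ n ↔ 8 * mismatch τ (towerProj L ⁻¹' B) w (θ x) ≤ n
      rw [mismatch_congr w fun k => hx k]
    rw [measureReal_def, measure_congr heq, hθ.measure_preimage_equiv]
    exact ENNReal.toReal_le_of_le_ofReal (Real.exp_pos _).le
      (measure_tower_mismatch μ L T.2 hB hB2 w)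

end Perturbation

/-! ### Automorphisms with complex itineraries are generic -/

section Generic

open scoped Topology

variable {X : Type*} [MeasurableSpace X] {μ : Measure X} {A : ℕ → Set X}

/-- The filter of neighbourhoods of `T` for the Halmos metric on representatives. -/
def halmosNhds (μ : Measure X) (A : ℕ → Set X) (T : MPEquiv μ) : Filter (MPEquiv μ) :=
  comap (preHalmosDist μ A T) (𝓝 0)

theorem halmosTerm_nonneg (S T : MPEquiv μ) (i : ℕ) : 0 ≤ halmosTerm μ A S T i :=
  add_nonneg measureReal_nonneg measureReal_nonneg

theorem preHalmosDist_comm (S T : MPEquiv μ) : preHalmosDist μ A S T = preHalmosDist μ A T S := by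
  simp only [preHalmosDist, halmosTerm, symmDiff_comm]

theorem measureReal_preimage_symmDiff (S : MPEquiv μ) (s t : Set X) :
    μ.real ((S.1 ⁻¹' s) ∆ (S.1 ⁻¹' t)) = μ.real (s ∆ t) := by
  rw [← preimage_symmDiff, measureReal_def, S.2.measure_preimage_equiv, measureReal_def]

theorem exists_ball_of_eventually {T : MPEquiv μ} {p : MPEquiv μ → Prop}
    (h : ∀ᶠ S in halmosNhds μ A T, p S) :
    ∃ ε > 0, ∀ S, preHalmosDist μ A T S < ε → p S := by
  rw [halmosNhds, eventually_comap, Metric.eventually_nhds_iff] at h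
  obtain ⟨ε, hε, h⟩ := h
  refine ⟨ε, hε, fun S hS => h ?_ S rfl⟩
  have h0 : 0 ≤ preHalmosDist μ A T S := tsum_nonneg fun i =>
    mul_nonneg (by positivity) (halmosTerm_nonneg T S i)
  rwa [Real.dist_eq, sub_zero, abs_of_nonneg h0]

variable [IsProbabilityMeasure μ]

theorem preimage_symmDiff_le_dist (S T : MPEquiv μ) (i : ℕ) :
    μ.real ((S.1 ⁻¹' A i) ∆ (T.1 ⁻¹' A i)) ≤ 2 ^ (i + 1) * preHalmosDist μ A S T := by
  have h1 : (1 / 2 : ℝ) ^ (i + 1) * halmosTerm μ A S T i ≤ preHalmosDist μ A S T :=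
    (summable_halmos μ A S T).le_tsum i fun j _ =>
      mul_nonneg (by positivity) (halmosTerm_nonneg S T j)
  have h2 : μ.real ((S.1 ⁻¹' A i) ∆ (T.1 ⁻¹' A i)) ≤ halmosTerm μ A S T i :=
    le_add_of_nonneg_left measureReal_nonneg
  calc _ ≤ halmosTerm μ A S T i := h2
    _ = 2 ^ (i + 1) * ((1 / 2 : ℝ) ^ (i + 1) * halmosTerm μ A S T i) := by
      rw [← mul_assoc, ← mul_pow]; norm_num
    _ ≤ _ := mul_le_mul_of_nonneg_left h1 (by positivity)

theorem measureReal_symmDiff_triangle (s t u : Set X) :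
    μ.real (s ∆ u) ≤ μ.real (s ∆ t) + μ.real (t ∆ u) :=
  (measureReal_mono (symmDiff_triangle _ _ _)).trans (measureReal_union_le _ _)

/-- The metric controls only the sets `A i`. Replacing `C` by a nearby `A i` costs the same small
amount under `T` and under `S`, as both preserve `μ`. -/
theorem eventually_preimage (hA : IsDenseFamily μ A) (T : MPEquiv μ) {C : Set X}
    (hC : MeasurableSet C) {η : ℝ} (hη : 0 < η) :
    ∀ᶠ S in halmosNhds μ A T, μ.real ((T.1 ⁻¹' C) ∆ (S.1 ⁻¹' C)) < η := by
  obtain ⟨i, hi⟩ := hA.2 C hC (η / 4) (by positivity)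
  have hε : 0 < η / 4 / 2 ^ (i + 1) := by positivity
  have : ∀ᶠ S in halmosNhds μ A T, preHalmosDist μ A T S < η / 4 / 2 ^ (i + 1) :=
    tendsto_comap.eventually (gt_mem_nhds hε)
  filter_upwards [this] with S hS
  have h1 := measureReal_symmDiff_triangle (μ := μ) (T.1 ⁻¹' C) (T.1 ⁻¹' A i) (S.1 ⁻¹' C)
  have h2 := measureReal_symmDiff_triangle (μ := μ) (T.1 ⁻¹' A i) (S.1 ⁻¹' A i) (S.1 ⁻¹' C)
  rw [measureReal_preimage_symmDiff, symmDiff_comm C] at h1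
  rw [measureReal_preimage_symmDiff S] at h2
  have h3 := preimage_symmDiff_le_dist (A := A) T S i
  have h4 : (2 : ℝ) ^ (i + 1) * preHalmosDist μ A T S < η / 4 := by
    rw [lt_div_iff₀ (by positivity)] at hS
    linarith
  linarith

/-- In the induction step `S ⁻¹` preserves the error already made, and the new error compares one
preimage of the fixed set `T^[k] ⁻¹' B`. -/
theorem eventually_iterate_preimage (hA : IsDenseFamily μ A) (T : MPEquiv μ) {B : Set X}
    (hB : MeasurableSet B) (k : ℕ) :
    ∀ {η : ℝ}, 0 < η → ∀ᶠ S in halmosNhds μ A T,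
      μ.real ((T.1^[k] ⁻¹' B) ∆ (S.1^[k] ⁻¹' B)) < η := by
  induction k with
  | zero => intro η hη; simp [hη]
  | succ k ih =>
    intro η hη
    have hC : MeasurableSet (T.1^[k] ⁻¹' B) := (T.2.iterate k).measurable hB
    filter_upwards [ih (half_pos hη), eventually_preimage hA T hC (half_pos hη)] with S h1 h2
    have h3 := measureReal_symmDiff_triangle (μ := μ) (T.1 ⁻¹' (T.1^[k] ⁻¹' B))
      (S.1 ⁻¹' (T.1^[k] ⁻¹' B)) (S.1 ⁻¹' (S.1^[k] ⁻¹' B))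
    rw [measureReal_preimage_symmDiff S] at h3
    rw [Function.iterate_succ, Function.iterate_succ, preimage_comp, preimage_comp]
    linarith

/-- Itineraries of length `n` under `S` and `T` differ only on a union of `n` small sets, which fits
into the gap left by the strict inequality. -/
theorem eventually_measure_mismatch_lt (hA : IsDenseFamily μ A) (T : MPEquiv μ) {B : Set X}
    (hB : MeasurableSet B) {n : ℕ} (w : Set (Fin n)) (q : ℕ) {a : ℝ}
    (ha : μ.real {x | q * mismatch T.1 B w x ≤ n} < a) :
    ∀ᶠ S in halmosNhds μ A T, μ.real {x | q * mismatch S.1 B w x ≤ n} < a := by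
  set b := μ.real {x | q * mismatch T.1 B w x ≤ n} with hb
  have hη : 0 < (a - b) / (n + 1) := div_pos (sub_pos.2 ha) (by positivity)
  have : ∀ᶠ S in halmosNhds μ A T, ∀ k : Fin n,
      μ.real ((T.1^[k] ⁻¹' B) ∆ (S.1^[k] ⁻¹' B)) < (a - b) / (n + 1) :=
    eventually_all.2 fun k => eventually_iterate_preimage hA T hB k hη
  filter_upwards [this] with S hS
  have hsub : {x | q * mismatch S.1 B w x ≤ n} ⊆ {x | q * mismatch T.1 B w x ≤ n} ∪
      ⋃ k : Fin n, (T.1^[k] ⁻¹' B) ∆ (S.1^[k] ⁻¹' B) := by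
    intro x hx
    by_cases h : ∃ k : Fin n, x ∈ (T.1^[k] ⁻¹' B) ∆ (S.1^[k] ⁻¹' B)
    · exact Or.inr (mem_iUnion.2 h)
    · left
      have hk : ∀ k : Fin n, T.1^[k] x ∈ B ↔ S.1^[k] x ∈ B := by
        intro k
        have := not_exists.1 h k
        simp only [mem_symmDiff, mem_preimage] at this
        tauto
      change q * mismatch T.1 B w x ≤ n
      rw [mismatch_congr w hk]
      exact hx
  have hsum : μ.real (⋃ k : Fin n, (T.1^[k] ⁻¹' B) ∆ (S.1^[k] ⁻¹' B)) ≤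
      n * ((a - b) / (n + 1)) := by
    refine (measureReal_iUnion_fintype_le _).trans ?_
    refine (Finset.sum_le_sum fun k _ => (hS k).le).trans ?_
    simp
  have hlt : n * ((a - b) / (n + 1)) < a - b := by
    rw [← mul_div_assoc, div_lt_iff₀ (by positivity)]
    nlinarith [sub_pos.2 ha]
  have := (measureReal_mono hsub).trans (measureReal_union_le (μ := μ) _ _)
  linarith

/-- At time `m ^ 2`, no word approximates the itineraries of a set of measure `2 ^ -(m + 1)`. -/
def IsComplexAt (B : Set X) (m : ℕ) (S : MPEquiv μ) : Prop :=
  ∀ w : Set (Fin (m ^ 2)), μ.real {x | 8 * mismatch S.1 B w x ≤ m ^ 2} < (1 / 2) ^ (m + 1)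

theorem eventually_isComplexAt (hA : IsDenseFamily μ A) {B : Set X} (hB : MeasurableSet B)
    {m : ℕ} {T : MPEquiv μ} (hT : IsComplexAt B m T) :
    ∀ᶠ S in halmosNhds μ A T, IsComplexAt B m S :=
  eventually_all.2 fun w => eventually_measure_mismatch_lt hA T hB w 8 (hT w)

/-- The automorphisms that are complex at time `m ^ 2`. -/
def complexSet (μ : Measure X) (B : Set X) (m : ℕ) : Set (Aut μ) :=
  {T | ∀ S : MPEquiv μ, (Quotient.mk (aeSetoid μ) S : Aut μ) = T → IsComplexAt B m S}

theorem isOpen_complexSet (hA : IsDenseFamily μ A) {B : Set X} (hB : MeasurableSet B) (m : ℕ) :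
    @IsOpen _ (halmosMetric μ A).toUniformSpace.toTopologicalSpace (complexSet μ B m) := by
  let _ := halmosMetric μ A
  rw [Metric.isOpen_iff]
  rintro ⟨T⟩ hT
  obtain ⟨ε, hε, h⟩ := exists_ball_of_eventually (eventually_isComplexAt hA hB (hT T rfl))
  refine ⟨ε, hε, ?_⟩
  rintro _ hS S rfl
  refine h S ?_
  rw [preHalmosDist_comm]
  exact hS

/-- Representatives of one class are at distance zero, so openness passes complexity from one of
them to all. -/
theorem mk_mem_complexSet (hA : IsDenseFamily μ A) {B : Set X} (hB : MeasurableSet B) {m : ℕ}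
    {T : MPEquiv μ} (hT : IsComplexAt B m T) :
    (Quotient.mk (aeSetoid μ) T : Aut μ) ∈ complexSet μ B m := by
  obtain ⟨ε, hε, h⟩ := exists_ball_of_eventually (eventually_isComplexAt hA hB hT)
  intro S hS
  refine h S ?_
  rw [preHalmosDist_congr A T S T T (Setoid.refl _) (Quotient.exact hS)]
  simpa [preHalmosDist, halmosTerm] using hε

/-- Here the quadratic time pays off: `m ^ 2 / (8 L) ≥ 2 m ≥ m + 1 > (m + 1) log 2`. -/
theorem exp_lt_half_pow {L m : ℕ} (hL : 0 < L) (hm : 16 * L ≤ m) :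
    Real.exp (-(((m ^ 2 : ℕ) : ℝ) / (8 * L))) < (1 / 2 : ℝ) ^ (m + 1) := by
  have hL' : (0 : ℝ) < L := by exact_mod_cast hL
  have hL1 : (1 : ℝ) ≤ L := by exact_mod_cast hL
  have hm' : (16 : ℝ) * L ≤ m := by exact_mod_cast hm
  have h1 : (1 / 2 : ℝ) ^ (m + 1) = Real.exp (-((m + 1 : ℕ) * Real.log 2)) := by
    rw [Real.exp_neg, Real.exp_nat_mul, Real.exp_log (by norm_num)]
    simp
  rw [h1, Real.exp_lt_exp, neg_lt_neg_iff]
  have h2 : Real.log 2 < 1 := Real.log_two_lt_d9.trans (by norm_num)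
  have h3 : (2 : ℝ) * m ≤ ((m ^ 2 : ℕ) : ℝ) / (8 * L) := by
    rw [le_div_iff₀ (by positivity)]
    push_cast
    nlinarith
  have h4 : ((m + 1 : ℕ) : ℝ) * Real.log 2 < (m + 1 : ℕ) * 1 :=
    mul_lt_mul_of_pos_left h2 (by positivity)
  refine h4.trans_le (le_trans ?_ h3)
  push_cast
  linarith

variable [StandardBorelSpace X] [NullSingletonClass μ]

/-- Every automorphism is a limit of automorphisms that are complex at all late times. -/
theorem exists_seq_complex (hA : IsDenseFamily μ A) {B : Set X} (hB : MeasurableSet B)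
    (hB2 : μ.real B = 1 / 2) (T : MPEquiv μ) :
    ∃ S : ℕ → MPEquiv μ, Tendsto (fun l => preHalmosDist μ A (S l) T) atTop (𝓝 0) ∧
      ∀ l m, 16 * (l + 1) ≤ m → IsComplexAt B m (S l) := by
  have hTA : ∀ i, MeasurableSet (T.1 '' A i) := fun i =>
    T.1.measurableSet_image.2 (hA.1 i)
  have key : ∀ l : ℕ, ∃ S : MPEquiv μ, (∀ i ≤ l, halmosTerm μ A S T i ≤ 2 * (1 / ((l : ℝ) + 1))) ∧
      ∀ m, 16 * (l + 1) ≤ m → IsComplexAt B m S := by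
    intro l
    -- The images `T '' A i` are included because the metric also compares images, and `μ (S A ∆ T
    -- A) = μ (S⁻¹ (T A) ∆ A)`.
    obtain ⟨S, hS, hS'⟩ := exists_perturbation T hB hB2
      (Sum.elim (fun i : Fin (l + 1) => A i) fun i : Fin (l + 1) => T.1 '' A i)
      (by rintro (i | i); exacts [hA.1 i, hTA i]) (l + 1)
    push_cast at hS
    refine ⟨S, fun i hi => ?_, fun m hm w => ?_⟩
    · have h1 := hS (Sum.inl ⟨i, Nat.lt_succ_of_le hi⟩)
      have h2 := hS (Sum.inr ⟨i, Nat.lt_succ_of_le hi⟩)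
      simp only [Sum.elim_inl, Sum.elim_inr] at h1 h2
      have h3 : μ.real ((S.1 '' A i) ∆ (T.1 '' A i)) =
          μ.real ((S.1 ⁻¹' (T.1 '' A i)) ∆ (T.1 ⁻¹' (T.1 '' A i))) := by
        rw [← measureReal_preimage_symmDiff S, preimage_image_eq _ S.1.injective,
          preimage_image_eq _ T.1.injective, symmDiff_comm]
      unfold halmosTerm
      rw [h3]
      linarith
    · refine (hS' (m ^ 2) w).trans_lt ?_
      exact exp_lt_half_pow (Nat.succ_pos l) hm
  choose S hS hS' using key
  refine ⟨S, ?_, hS'⟩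
  have h0 : ∑' i : ℕ, (0 : ℝ) = 0 := tsum_zero
  rw [← h0]
  refine tendsto_tsum_of_dominated_convergence (bound := fun i : ℕ => (1 / 2 : ℝ) ^ i)
    summable_geometric_two (fun i => ?_) (Eventually.of_forall fun l i => ?_)
  · have hlim : Tendsto (fun l : ℕ => (1 / 2 : ℝ) ^ (i + 1) * (2 * (1 / ((l : ℝ) + 1)))) atTop
        (𝓝 0) := by
      simpa using (tendsto_one_div_add_atTop_nhds_zero_nat (𝕜 := ℝ)).const_mul 2 |>.const_mul
        ((1 / 2 : ℝ) ^ (i + 1))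
    refine squeeze_zero' (Eventually.of_forall fun l =>
      mul_nonneg (by positivity) (halmosTerm_nonneg _ _ _)) ?_ hlim
    filter_upwards [eventually_ge_atTop i] with l hl
    exact mul_le_mul_of_nonneg_left (hS l i hl) (by positivity)
  · rw [Real.norm_of_nonneg (mul_nonneg (by positivity) (halmosTerm_nonneg _ _ _))]
    have h : halmosTerm μ A (S l) T i ≤ 1 + 1 := add_le_add measureReal_le_one measureReal_le_one
    calc (1 / 2 : ℝ) ^ (i + 1) * halmosTerm μ A (S l) T i ≤ (1 / 2 : ℝ) ^ (i + 1) * (1 + 1) :=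
          mul_le_mul_of_nonneg_left h (by positivity)
      _ = (1 / 2 : ℝ) ^ i := by ring

/-- Generically, an automorphism is complex at infinitely many times. -/
theorem isGeneric_frequently_complex (hA : IsDenseFamily μ A) {B : Set X} (hB : MeasurableSet B)
    (hB2 : μ.real B = 1 / 2) :
    IsGenericProperty μ A fun T => ∀ N, ∃ m ≥ N, T ∈ complexSet μ B m := by
  let _ := halmosMetric μ A
  refine ⟨⋂ N : ℕ, ⋃ m ≥ N, complexSet μ B m, ?_, ?_, ?_⟩
  · exact IsGδ.iInter_of_isOpen fun N => isOpen_biUnion fun m _ => isOpen_complexSet hA hB m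
  · rw [Metric.dense_iff]
    rintro ⟨T⟩ ε hε
    obtain ⟨S, hS, hS'⟩ := exists_seq_complex hA hB hB2 T
    obtain ⟨l, hl⟩ := (hS.eventually (gt_mem_nhds hε)).exists
    refine ⟨Quotient.mk _ (S l), hl, ?_⟩
    -- The one perturbation `S l` lies in the union for every `N`, so density of the intersection
    -- needs no Baire category argument.
    refine mem_iInter.2 fun N => mem_iUnion₂.2 ⟨N + 16 * (l + 1), Nat.le_add_right _ _, ?_⟩
    exact mk_mem_complexSet hA hB (hS' l _ (Nat.le_add_left _ _))
  · intro T hT N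
    simpa using mem_iInter.1 hT N

end Generic

/-! ### Figure exchanges have polynomially many itineraries -/

section Counting

open scoped Topology

variable {X : Type*} [MeasurableSpace X] {μ : Measure X} [IsProbabilityMeasure μ]

/-- If most points are coded by few symbols, in such a way that points with the same code have
close itineraries, then the automorphism is not complex. -/
theorem not_isComplexAt_of_code (S : MPEquiv μ) (B : Set X) {m : ℕ} {G : Set X}
    (hG : μ.real Gᶜ < 1 / 2) {κ : Type*} (code : X → κ) (c : Finset κ) (hc : c.card ≤ 2 ^ m)
    (hcode : ∀ x ∈ G, code x ∈ c)
    (hclose : ∀ x ∈ G, ∀ y ∈ G, code x = code y →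
      8 * mismatch S.1 B {k : Fin (m ^ 2) | S.1^[k] y ∈ B} x ≤ m ^ 2) :
    ¬ IsComplexAt B m S := by
  intro h
  have hG' : 1 / 2 < μ.real G := by
    have h1 := measureReal_union_le (μ := μ) G Gᶜ
    rw [union_compl_self, probReal_univ] at h1
    linarith
  have hcell : ∀ a ∈ c, μ.real {x ∈ G | code x = a} ≤ (1 / 2) ^ (m + 1) := by
    intro a _
    rcases ({x ∈ G | code x = a} : Set X).eq_empty_or_nonempty with he | ⟨y, hy⟩
    · rw [he, measureReal_empty]; positivity
    · refine le_trans (measureReal_mono ?_) (h {k : Fin (m ^ 2) | S.1^[k] y ∈ B}).le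
      intro x hx
      exact hclose x hx.1 y hy.1 (hx.2.trans hy.2.symm)
  have hcover : G ⊆ ⋃ a ∈ c, {x ∈ G | code x = a} := fun x hx =>
    mem_iUnion₂.2 ⟨code x, hcode x hx, hx, rfl⟩
  have : μ.real G ≤ 1 / 2 := by
    calc μ.real G ≤ μ.real (⋃ a ∈ c, {x ∈ G | code x = a}) := measureReal_mono hcover (measure_ne_top _ _)
      _ ≤ ∑ a ∈ c, μ.real {x ∈ G | code x = a} :=
        measureReal_biUnion_finset_le _ _
      _ ≤ ∑ a ∈ c, (1 / 2) ^ (m + 1) := Finset.sum_le_sum hcell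
      _ = c.card * (1 / 2) ^ (m + 1) := by simp
      _ ≤ (2 : ℝ) ^ m * (1 / 2) ^ (m + 1) := by
        refine mul_le_mul_of_nonneg_right ?_ (by positivity)
        exact_mod_cast hc
      _ = 1 / 2 := by
        rw [pow_succ, ← mul_assoc, ← mul_pow]; norm_num
  linarith

-- Markov's inequality for the number of `k` with `x ∈ D k`, whose mean is at most `n * a`.
open Classical in
theorem measure_lt_card_le {n q : ℕ} (hn : 0 < n) (D : Fin n → Set X)
    (hD : ∀ k, MeasurableSet (D k)) {a : ℝ}
    (ha : ∀ k, μ.real (D k) ≤ a) :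
    μ.real {x | n < q * (Finset.univ.filter fun k => x ∈ D k).card} ≤ q * a := by
  have hn' : (0 : ℝ) < n := by exact_mod_cast hn
  let f : X → ℝ := fun x => q * ∑ k, (D k).indicator (fun _ => (1 : ℝ)) x
  have hind : ∀ k, Integrable ((D k).indicator fun _ => (1 : ℝ)) μ := fun k =>
    (integrable_const 1).indicator (hD k)
  have hf0 : ∀ x, 0 ≤ f x := fun x => mul_nonneg (Nat.cast_nonneg q)
    (Finset.sum_nonneg fun k _ => indicator_nonneg (fun _ _ => zero_le_one) _)
  have hfi : Integrable f μ := (integrable_finsetSum _ fun k _ => hind k).const_mul _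
  have hint : ∫ x, f x ∂μ ≤ n * (q * a) := by
    rw [integral_const_mul, integral_finsetSum _ fun k _ => hind k]
    simp_rw [integral_indicator_const _ (hD _), smul_eq_mul, mul_one]
    calc (q : ℝ) * ∑ k, μ.real (D k) ≤ q * ∑ _ : Fin n, a :=
          mul_le_mul_of_nonneg_left (Finset.sum_le_sum fun k _ => ha k) (Nat.cast_nonneg q)
      _ = n * (q * a) := by simp; ring
  have hmarkov := mul_meas_ge_le_integral_of_nonneg (Eventually.of_forall hf0) hfi n
  refine le_of_mul_le_mul_left (le_trans ?_ (hmarkov.trans hint)) hn'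
  refine mul_le_mul_of_nonneg_left (measureReal_mono fun x hx => ?_) hn'.le
  have hx' : n < q * (Finset.univ.filter fun k => x ∈ D k).card := hx
  have hcard : ((Finset.univ.filter fun k => x ∈ D k).card : ℝ) =
      ∑ k, (D k).indicator (fun _ => (1 : ℝ)) x := by
    rw [Finset.card_filter]
    push_cast
    exact Finset.sum_congr rfl fun k _ => by simp [indicator_apply]
  change (n : ℝ) ≤ q * ∑ k, (D k).indicator (fun _ => (1 : ℝ)) x
  rw [← hcard]
  exact_mod_cast hx'.le

end Counting

/-! ### Rigidity of orbits away from the boundaries -/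

section LocalIsometry

variable {d : ℕ} (E : IsometricExchange d)

/-- A ball is connected, so if it misses the frontier of `F` it lies entirely inside or entirely
outside `F`. -/
theorem subset_of_disjoint_frontier {F : Set (EuclideanSpace ℝ (Fin d))}
    {x y : EuclideanSpace ℝ (Fin d)} {r : ℝ} (hx : x ∉ Metric.thickening r (frontier F))
    (hy : y ∈ Metric.ball x r) (hyF : y ∈ F) : Metric.ball x r ⊆ F := by
  have hfr : ∀ u ∈ Metric.ball x r, u ∉ frontier F := fun u hu hu' =>
    hx (Metric.mem_thickening_iff.2 ⟨u, hu', by rw [dist_comm]; exact hu⟩)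
  have hint : ∀ u ∈ Metric.ball x r, u ∈ closure F → u ∈ interior F := by
    intro u hu hc
    by_contra h
    exact hfr u hu ⟨hc, h⟩
  by_contra hsub
  obtain ⟨z, hz, hzF⟩ := not_subset.1 hsub
  obtain ⟨u, -, hu, hu'⟩ := (convex_ball x r).isPreconnected (interior F) (closure F)ᶜ
    isOpen_interior isClosed_closure.isOpen_compl
    (fun u hu => by
      by_cases h : u ∈ closure F
      · exact Or.inl (hint u hu h)
      · exact Or.inr h)
    ⟨y, hy, hint y hy (subset_closure hyF)⟩
    ⟨z, hz, fun h => hzF (interior_subset (hint z hz h))⟩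
  exact hu' (subset_closure (interior_subset hu))

/-- Away from the boundaries of the pieces, the exchange is locally an isometry. -/
theorem IsometricExchange.exists_eqOn_ball {x : EuclideanSpace ℝ (Fin d)} {r : ℝ} (hr : 0 < r)
    (hx : x ∈ closure E.domain)
    (hx' : ∀ i, x ∉ Metric.thickening r (frontier (E.piece i))) :
    ∃ i, ∀ y ∈ Metric.ball x r, E.map y = E.isom i y := by
  rw [IsometricExchange.domain, closure_iUnion_of_finite, mem_iUnion] at hx
  obtain ⟨i, hi⟩ := hx
  have hxi : x ∈ E.piece i := by
    by_contra h
    exact hx' i (Metric.self_subset_thickening hr _ ⟨hi, fun h' => h (interior_subset h')⟩)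
  have hball : Metric.ball x r ⊆ E.piece i :=
    subset_of_disjoint_frontier (hx' i) (Metric.mem_ball_self hr) hxi
  refine ⟨i, fun y hy => ?_⟩
  have h : ∃ j, y ∈ E.piece j := ⟨i, hball hy⟩
  -- Any piece containing `y` contains the whole ball, and two different pieces cannot overlap in a
  -- set of positive volume.
  have hj : h.choose = i := by
    by_contra hne
    have h2 := subset_of_disjoint_frontier (hx' h.choose) hy h.choose_spec
    have h3 : volume (Metric.ball x r) = 0 :=
      measure_mono_null (subset_inter h2 hball) (E.piece_disjoint _ _ hne)
    exact (Metric.measure_ball_pos volume x hr).ne' h3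
  rw [IsometricExchange.map, dif_pos h, hj]

/-- At each step the second orbit is still in the `r`-ball around the first, where the exchange is a
single isometry. Only the orbit of `x` has to avoid the boundaries. -/
theorem IsometricExchange.dist_iterate {x y : EuclideanSpace ℝ (Fin d)} {r : ℝ} {n : ℕ}
    (hr : 0 < r) (hx : ∀ k < n, E.map^[k] x ∈ closure E.domain)
    (hx' : ∀ k < n, ∀ i, E.map^[k] x ∉ Metric.thickening r (frontier (E.piece i)))
    (hxy : dist y x < r) : ∀ k ≤ n, dist (E.map^[k] y) (E.map^[k] x) = dist y x := by
  intro k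
  induction k with
  | zero => intro _; rfl
  | succ k ih =>
    intro hk
    have hk' := ih (Nat.le_of_succ_le hk)
    obtain ⟨i, hi⟩ := E.exists_eqOn_ball hr (hx k hk) (hx' k hk)
    rw [Function.iterate_succ_apply', Function.iterate_succ_apply',
      hi _ (by rw [Metric.mem_ball, hk']; exact hxy), hi _ (Metric.mem_ball_self hr),
      (E.isom i).dist_eq, hk']

end LocalIsometry

/-! ### Grid cells as codes for points -/

section Grid

variable {d : ℕ}

/-- The cell of the grid with mesh `1 / K` that contains `x`. -/
def gridCode (K : ℕ) (x : EuclideanSpace ℝ (Fin d)) : Fin d → ℤ := fun i => ⌊x i * K⌋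

theorem gridCode_mem {K R : ℕ} {x : EuclideanSpace ℝ (Fin d)} (hx : ‖x‖ ≤ R) :
    gridCode K x ∈ Fintype.piFinset fun _ : Fin d => Finset.Icc (-(R * K : ℕ) : ℤ) (R * K : ℕ) := by
  rw [Fintype.mem_piFinset]
  intro i
  have h := abs_le.1 ((Real.norm_eq_abs _ ▸ PiLp.norm_apply_le x i).trans hx)
  have hK : (0 : ℝ) ≤ K := Nat.cast_nonneg K
  rw [Finset.mem_Icc]
  constructor
  · refine Int.le_floor.2 ?_
    push_cast
    nlinarith [mul_le_mul_of_nonneg_right h.1 hK]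
  · refine Int.cast_le (R := ℝ).1 ((Int.floor_le _).trans ?_)
    push_cast
    exact mul_le_mul_of_nonneg_right h.2 hK

theorem card_gridCode (M : ℕ) :
    (Fintype.piFinset fun _ : Fin d => Finset.Icc (-(M : ℕ) : ℤ) (M : ℕ)).card =
      (2 * M + 1) ^ d := by
  rw [Fintype.card_piFinset]
  simp only [Int.card_Icc, Finset.prod_const, Finset.card_univ, Fintype.card_fin]
  congr 1
  omega

/-- Coordinates in one cell differ by less than `1 / K`, so the distance is at most `√d / K`; using
`d + 1` keeps the final inequality strict even for `d = 0`. -/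
theorem dist_lt_of_gridCode_eq {K : ℕ} {r : ℝ} (hK : d + 1 ≤ r * K) (hr : 0 < r)
    {x y : EuclideanSpace ℝ (Fin d)} (h : gridCode K x = gridCode K y) : dist x y < r := by
  have hK0 : (0 : ℝ) < K := by
    by_contra hneg
    have : (K : ℝ) = 0 := le_antisymm (not_lt.1 hneg) (Nat.cast_nonneg K)
    rw [this, mul_zero] at hK
    linarith [(Nat.cast_nonneg d : (0 : ℝ) ≤ d)]
  have hi : ∀ i, dist (x i) (y i) ^ 2 ≤ (1 / K : ℝ) ^ 2 := by
    intro i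
    have h1 := Int.abs_sub_lt_one_of_floor_eq_floor (congrFun h i)
    rw [← sub_mul, abs_mul, abs_of_pos hK0, ← lt_div_iff₀ hK0] at h1
    rw [Real.dist_eq]
    gcongr
  rw [EuclideanSpace.dist_eq, Real.sqrt_lt' hr]
  calc ∑ i, dist (x i) (y i) ^ 2 ≤ ∑ _ : Fin d, (1 / K : ℝ) ^ 2 :=
        Finset.sum_le_sum fun i _ => hi i
    _ = d * (1 / K : ℝ) ^ 2 := by simp
    _ < (d + 1) ^ 2 * (1 / K : ℝ) ^ 2 := by
        refine mul_lt_mul_of_pos_right ?_ (by positivity)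
        nlinarith [(Nat.cast_nonneg d : (0 : ℝ) ≤ d)]
    _ = ((d + 1) / K) ^ 2 := by ring
    _ ≤ r ^ 2 := by
        have : (d + 1) / K ≤ r := (div_le_iff₀ hK0).2 hK
        gcongr

end Grid

/-! ### Figure exchanges are not complex -/

section FigureExchange

open scoped Topology

variable {d : ℕ} (E : IsometricExchange d)

theorem IsometricExchange.measure_le (t : Set (EuclideanSpace ℝ (Fin d))) :
    E.measure t ≤ (volume E.domain)⁻¹ * volume t := by
  rw [IsometricExchange.measure, ProbabilityTheory.cond, Measure.smul_apply, smul_eq_mul]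
  exact mul_le_mul_right (Measure.restrict_apply_le _ _) _

/-- The pieces are not assumed measurable; the closure of the domain is, and it suffices for
locating a piece around the point. -/
theorem IsometricExchange.ae_mem_closure : ∀ᵐ y ∂E.measure, y ∈ closure E.domain := by
  rw [ae_iff, IsometricExchange.measure, ProbabilityTheory.cond, Measure.smul_apply, smul_eq_mul]
  have h : {y | y ∉ closure E.domain} = (closure E.domain)ᶜ := rfl
  rw [h, Measure.restrict_apply isClosed_closure.measurableSet.compl]
  have : (closure E.domain)ᶜ ∩ E.domain = ∅ := by
    ext y
    simp only [mem_inter_iff, mem_compl_iff, mem_empty_iff_false, iff_false, not_and]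
    exact fun h h' => h (subset_closure h')
  simp [this]

/-- The neighbourhoods of the boundaries of the pieces have polynomially small measure; the scale
`m ^ -p` makes it `O(m ^ -3)`. -/
theorem IsometricExchange.exists_measure_thickening_le (hE : E.IsFigureExchange) :
    ∃ (p : ℕ) (C : ℝ), p ≠ 0 ∧ ∀ m : ℕ, 0 < m → ∀ i,
      E.measure.real (Metric.thickening (1 / (m : ℝ) ^ p) (frontier (E.piece i))) ≤
        C * (1 / m) ^ 3 := by
  choose hbd C s hs hC using hE
  -- With `p * s i ≥ 3` the bound `r ^ s i` at `r = m ^ -p` is at most `m ^ -3`, summable over `m ^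
  -- 2` times to `O(1 / m)`; `p ≠ 0` makes `r` tend to zero.
  obtain ⟨p, hp0, hp⟩ : ∃ p : ℕ, p ≠ 0 ∧ ∀ i, 3 ≤ p * s i := by
    have h1 : ∀ i, ∃ p : ℕ, 3 / s i ≤ p := fun i => exists_nat_ge _
    choose p hp using h1
    refine ⟨Finset.univ.sup p + 1, Nat.succ_ne_zero _, fun i => ?_⟩
    have h2 : (p i : ℝ) ≤ (Finset.univ.sup p + 1 : ℕ) := by
      exact_mod_cast (Finset.le_sup (f := p) (Finset.mem_univ i)).trans (Nat.le_succ _)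
    rw [← div_le_iff₀ (hs i)]
    exact (hp i).trans h2
  refine ⟨p, ((volume E.domain)⁻¹).toReal * ∑ i, |C i|, hp0, fun m hm i => ?_⟩
  have hm1 : (1 : ℝ) ≤ m := by exact_mod_cast hm
  have hm0 : (0 : ℝ) < m := by linarith
  have hr0 : 0 < 1 / (m : ℝ) ^ p := by positivity
  have hr1 : 1 / (m : ℝ) ^ p ≤ 1 := by
    rw [div_le_one (by positivity)]; exact one_le_pow₀ hm1
  have hpow : (1 / (m : ℝ) ^ p) ^ s i ≤ (1 / (m : ℝ)) ^ 3 := by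
    have e1 : 1 / (m : ℝ) ^ p = (1 / (m : ℝ)) ^ (p : ℝ) := by
      rw [Real.rpow_natCast, one_div_pow]
    rw [e1, ← Real.rpow_mul (by positivity), ← Real.rpow_natCast]
    refine Real.rpow_le_rpow_of_exponent_ge (by positivity) ?_ (by exact_mod_cast hp i)
    rw [div_le_one hm0]; exact hm1
  have hV : (volume E.domain)⁻¹ ≠ ⊤ := ENNReal.inv_ne_top.2 E.volume_ne_zero
  have hle : C i * (1 / (m : ℝ) ^ p) ^ s i ≤ (∑ i, |C i|) * (1 / (m : ℝ)) ^ 3 := by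
    refine mul_le_mul ?_ hpow (by positivity) (Finset.sum_nonneg fun i _ => abs_nonneg _)
    exact (le_abs_self _).trans
      (Finset.single_le_sum (f := fun i => |C i|) (fun i _ => abs_nonneg _) (Finset.mem_univ i))
  have h1 := (E.measure_le _).trans (mul_le_mul_right ((hC i _ hr0 hr1).trans
    (ENNReal.ofReal_le_ofReal hle)) (volume E.domain)⁻¹)
  have h2 := ENNReal.toReal_mono (ENNReal.mul_ne_top hV ENNReal.ofReal_ne_top) h1
  rw [ENNReal.toReal_mul, ENNReal.toReal_ofReal (mul_nonneg
    (Finset.sum_nonneg fun i _ => abs_nonneg _) (by positivity))] at h2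
  rw [mul_assoc]
  exact h2

theorem IsometricExchange.exists_norm_le (hE : E.IsFigureExchange) :
    ∃ R : ℕ, ∀ y ∈ closure E.domain, ‖y‖ ≤ R := by
  have h1 : Bornology.IsBounded E.domain :=
    Bornology.isBounded_iUnion.2 fun i => (hE i).1
  obtain ⟨R, hR⟩ := (Metric.isBounded_closure_of_isBounded h1).exists_norm_le
  obtain ⟨N, hN⟩ := exists_nat_ge R
  exact ⟨N, fun y hy => (hR y hy).trans hN⟩

theorem eventually_card_le (c p d : ℕ) : ∀ᶠ m : ℕ in atTop, (2 * (c * m ^ p) + 1) ^ d ≤ 2 ^ m := by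
  have h := (tendsto_pow_const_div_const_pow_of_one_lt (p * d) (r := 2) one_lt_two).const_mul
    (((2 * c + 1) ^ d : ℕ) : ℝ)
  rw [mul_zero] at h
  filter_upwards [h.eventually (gt_mem_nhds one_pos), eventually_ge_atTop 1] with m hm hm1
  have h1 : 2 * (c * m ^ p) + 1 ≤ (2 * c + 1) * m ^ p := by
    have := Nat.one_le_pow p m hm1
    nlinarith
  refine (Nat.pow_le_pow_left h1 d).trans ?_
  rw [mul_pow, ← pow_mul]
  rw [← mul_div_assoc, div_lt_one (by positivity)] at hm
  exact_mod_cast hm.le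

/-- A measurable set is recognized up to a small error by a pair of compact sets at a positive
distance. -/
theorem exists_separated {ν : Measure (EuclideanSpace ℝ (Fin d))} [IsFiniteMeasure ν]
    {B : Set (EuclideanSpace ℝ (Fin d))} (hB : MeasurableSet B) {ε : ℝ} (hε : 0 < ε) :
    ∃ Z : Set (EuclideanSpace ℝ (Fin d)), MeasurableSet Z ∧ ν.real Z ≤ ε ∧ ∃ δ > 0,
      ∀ y ∉ Z, ∀ z ∉ Z, dist y z < δ → (y ∈ B ↔ z ∈ B) := by
  have hε' : ENNReal.ofReal (ε / 2) ≠ 0 := by simpa using hε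
  obtain ⟨K, hKB, hK, hKm⟩ := hB.exists_isCompact_sdiff_lt (measure_ne_top ν B) hε'
  obtain ⟨K', hKB', hK', hKm'⟩ := hB.compl.exists_isCompact_sdiff_lt (measure_ne_top ν Bᶜ) hε'
  obtain ⟨δ, hδ, hdis⟩ := (disjoint_compl_right.mono hKB hKB').exists_thickenings hK hK'.isClosed
  have hsep : ∀ y ∈ K, ∀ z ∈ K', ¬ dist y z < δ := fun y hy z hz h =>
    disjoint_left.1 hdis (Metric.self_subset_thickening hδ K hy)
      (Metric.mem_thickening_iff.2 ⟨z, hz, h⟩)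
  refine ⟨(B \ K) ∪ (Bᶜ \ K'), (hB.diff hK.measurableSet).union
    (hB.compl.diff hK'.measurableSet), ?_, δ, hδ, ?_⟩
  · refine (measureReal_union_le _ _).trans ?_
    have h1 := ENNReal.toReal_le_of_le_ofReal (by positivity) hKm.le
    have h2 := ENNReal.toReal_le_of_le_ofReal (by positivity) hKm'.le
    rw [measureReal_def, measureReal_def]
    linarith
  · have hmem : ∀ y, y ∉ (B \ K) ∪ (Bᶜ \ K') → (y ∈ B → y ∈ K) ∧ (y ∉ B → y ∈ K') := by
      intro y hy
      constructor
      · intro h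
        by_contra h'
        exact hy (Or.inl ⟨h, h'⟩)
      · intro h
        by_contra h'
        exact hy (Or.inr ⟨h, h'⟩)
    intro y hy z hz hyz
    constructor
    · intro h
      by_contra h'
      exact hsep y ((hmem y hy).1 h) z ((hmem z hz).2 h') hyz
    · intro h
      by_contra h'
      exact hsep z ((hmem z hz).1 h) y ((hmem y hy).2 h') (by rwa [dist_comm])

variable {X : Type*} [MeasurableSpace X] {μ : Measure X} [IsProbabilityMeasure μ]

open Classical in
/-- An automorphism isomorphic to a figure exchange is not complex at any late time. -/
theorem eventually_not_isComplexAt {E : IsometricExchange d} (hE : E.IsFigureExchange)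
    {S : MPEquiv μ} (hS : IsIsomorphic μ S.1 E.measure E.map) {B : Set X}
    (hB : MeasurableSet B) : ∀ᶠ m in atTop, ¬ IsComplexAt B m S := by
  obtain ⟨φ, ψ, hφ, hψ, hψφ, -, hint⟩ := hS
  have hprob : IsProbabilityMeasure E.measure := hφ.map_eq ▸
    Measure.isProbabilityMeasure_map hφ.measurable.aemeasurable
  obtain ⟨p, C, hp0, hC⟩ := E.exists_measure_thickening_le hE
  obtain ⟨R, hR⟩ := E.exists_norm_le hE
  -- With measure at most 1/64, Markov's inequality bounds by 1/4 the set of points that visit `Z`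
  -- more than 1/16 of the time.
  obtain ⟨Z, hZ, hZm, δ, hδ, hsep⟩ := exists_separated (ν := E.measure)
    (hψ.measurable hB) (ε := 1 / 64) (by norm_num)
  have hSk : ∀ k : ℕ, MeasurePreserving (S.1^[k]) μ μ := fun k => S.2.iterate k
  have hφk : ∀ k : ℕ, MeasurePreserving (fun x => φ (S.1^[k] x)) μ E.measure := fun k =>
    hφ.comp (hSk k)
  have hae : ∀ᵐ x ∂μ, (∀ k, φ (S.1^[k] x) = E.map^[k] (φ x)) ∧
      (∀ k, φ (S.1^[k] x) ∈ closure E.domain) ∧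
      ∀ k, S.1^[k] x ∈ B ↔ φ (S.1^[k] x) ∈ ψ ⁻¹' B := by
    have h1 : ∀ᵐ x ∂μ, ∀ k, φ (S.1 (S.1^[k] x)) = E.map (φ (S.1^[k] x)) :=
      ae_all_iff.2 fun k => (hSk k).quasiMeasurePreserving.ae hint
    have h2 : ∀ᵐ x ∂μ, ∀ k, φ (S.1^[k] x) ∈ closure E.domain :=
      ae_all_iff.2 fun k => (hφk k).quasiMeasurePreserving.ae E.ae_mem_closure
    have h3 : ∀ᵐ x ∂μ, ∀ k, ψ (φ (S.1^[k] x)) = S.1^[k] x :=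
      ae_all_iff.2 fun k => (hSk k).quasiMeasurePreserving.ae hψφ
    filter_upwards [h1, h2, h3] with x h1 h2 h3
    refine ⟨fun k => ?_, h2, fun k => ?_⟩
    · induction k with
      | zero => rfl
      | succ k ih => rw [Function.iterate_succ_apply', Function.iterate_succ_apply', h1, ih]
    · rw [mem_preimage, h3]
  have hlim : Tendsto (fun m : ℕ => (E.n * C) * (1 / (m : ℝ))) atTop (𝓝 0) := by
    simpa using (tendsto_one_div_atTop_nhds_zero_nat (𝕜 := ℝ)).const_mul (E.n * C)
  have hlim2 : ∀ᶠ m : ℕ in atTop, 1 / (m : ℝ) ^ p < δ := by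
    have : Tendsto (fun m : ℕ => (1 / (m : ℝ)) ^ p) atTop (𝓝 0) := by
      simpa [hp0] using (tendsto_one_div_atTop_nhds_zero_nat (𝕜 := ℝ)).pow p
    filter_upwards [this.eventually (gt_mem_nhds hδ)] with m hm
    rwa [one_div_pow] at hm
  filter_upwards [hlim.eventually (gt_mem_nhds (show (0 : ℝ) < 1 / 4 by norm_num)), hlim2,
    eventually_card_le (R * (d + 1)) p d, eventually_ge_atTop 1] with m hm hmδ hcard hm1
  have hm0 : (0 : ℝ) < m := by exact_mod_cast hm1
  set r : ℝ := 1 / (m : ℝ) ^ p with hr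
  have hr0 : 0 < r := by positivity
  let bad : Set X := ⋃ k : Fin (m ^ 2), ⋃ i,
    (fun x => φ (S.1^[k] x)) ⁻¹' Metric.thickening r (frontier (E.piece i))
  let bad' : Set X := {x | m ^ 2 < 16 * (Finset.univ.filter fun k : Fin (m ^ 2) =>
    x ∈ (fun x => φ (S.1^[k] x)) ⁻¹' Z).card}
  let G : Set X := {x | ((∀ k, φ (S.1^[k] x) = E.map^[k] (φ x)) ∧
      (∀ k, φ (S.1^[k] x) ∈ closure E.domain) ∧
      ∀ k, S.1^[k] x ∈ B ↔ φ (S.1^[k] x) ∈ ψ ⁻¹' B) ∧ x ∉ bad ∧ x ∉ bad'}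
  have hbad : μ.real bad < 1 / 4 := by
    calc μ.real bad ≤ ∑ _ : Fin (m ^ 2), ∑ _ : Fin E.n, C * (1 / (m : ℝ)) ^ 3 := by
          refine (measureReal_iUnion_fintype_le _).trans (Finset.sum_le_sum fun k _ => ?_)
          refine (measureReal_iUnion_fintype_le _).trans (Finset.sum_le_sum fun i _ => ?_)
          rw [(hφk k).measureReal_preimage Metric.isOpen_thickening.nullMeasurableSet]
          exact hC m hm1 i
      _ = E.n * C * (1 / (m : ℝ)) := by
          simp only [Finset.sum_const, Finset.card_univ, Fintype.card_fin, nsmul_eq_mul]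
          push_cast
          field_simp
      _ < 1 / 4 := hm
  have hbad' : μ.real bad' ≤ 1 / 4 := by
    have h := measure_lt_card_le (μ := μ) (q := 16) (n := m ^ 2) (by positivity)
      (fun k => (fun x => φ (S.1^[k] x)) ⁻¹' Z) (fun k => (hφk k).measurable hZ) (a := 1 / 64)
      (fun k => by rw [(hφk k).measureReal_preimage hZ.nullMeasurableSet]; exact hZm)
    refine h.trans ?_
    norm_num
  have hG : μ.real Gᶜ < 1 / 2 := by
    have hsub : (Gᶜ : Set X) ≤ᵐ[μ] (bad ∪ bad' : Set X) := by
      filter_upwards [hae] with x hx hxG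
      by_contra h
      exact hxG ⟨hx, fun h' => h (Or.inl h'), fun h' => h (Or.inr h')⟩
    have h1 : μ.real Gᶜ ≤ μ.real (bad ∪ bad') :=
      ENNReal.toReal_mono (measure_ne_top _ _) (measure_mono_ae hsub)
    have h2 := measureReal_union_le (μ := μ) bad bad'
    linarith
  -- The mesh is chosen so that equality holds: cells have diameter below `r`, yet their number is
  -- polynomial in `m`.
  have hK : ((d : ℝ) + 1) ≤ r * ((d + 1) * m ^ p : ℕ) := by
    rw [hr]
    push_cast
    field_simp
    exact le_rfl
  refine not_isComplexAt_of_code S B hG (fun x => gridCode ((d + 1) * m ^ p) (φ x))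
    (Fintype.piFinset fun _ : Fin d => Finset.Icc (-(R * ((d + 1) * m ^ p) : ℕ) : ℤ)
      (R * ((d + 1) * m ^ p) : ℕ)) ?_ (fun x hx => ?_) (fun x hx y hy hxy => ?_)
  · rw [card_gridCode, ← mul_assoc R]
    exact hcard
  · exact gridCode_mem (hR _ (hx.1.2.1 0))
  · have hdist : dist (φ x) (φ y) < r := dist_lt_of_gridCode_eq hK hr0 hxy
    have hclose : ∀ k : Fin (m ^ 2), φ (S.1^[k] x) ∉ Z → φ (S.1^[k] y) ∉ Z →
        (S.1^[k] x ∈ B ↔ S.1^[k] y ∈ B) := by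
      intro k hx' hy'
      rw [hx.1.2.2, hy.1.2.2]
      refine hsep _ hx' _ hy' ?_
      rw [hx.1.1, hy.1.1, E.dist_iterate hr0 (n := m ^ 2) (fun j _ => ?_) (fun j hj i h => ?_)
        hdist k k.2.le]
      · exact hdist.trans hmδ
      · rw [← hy.1.1]; exact hy.1.2.1 j
      · rw [← hy.1.1] at h
        exact hy.2.1 (mem_iUnion₂.2 ⟨⟨j, hj⟩, i, h⟩)
    have hxc : 16 * (Finset.univ.filter fun k : Fin (m ^ 2) => φ (S.1^[k] x) ∈ Z).card ≤ m ^ 2 :=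
      not_lt.1 hx.2.2
    have hyc : 16 * (Finset.univ.filter fun k : Fin (m ^ 2) => φ (S.1^[k] y) ∈ Z).card ≤ m ^ 2 :=
      not_lt.1 hy.2.2
    -- A mismatch forces one of the two orbits into `Z`; two proportions of at most 1/16 add up to
    -- the 1/8 in `IsComplexAt`.
    have hmis : mismatch S.1 B {k : Fin (m ^ 2) | S.1^[k] y ∈ B} x ≤
        (Finset.univ.filter fun k : Fin (m ^ 2) => φ (S.1^[k] x) ∈ Z).card +
        (Finset.univ.filter fun k : Fin (m ^ 2) => φ (S.1^[k] y) ∈ Z).card := by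
      refine le_trans (Finset.card_le_card fun k hk => ?_) (Finset.card_union_le _ _)
      by_contra h
      simp only [Finset.mem_union, Finset.mem_filter, Finset.mem_univ, true_and, not_or] at h
      exact (Finset.mem_filter.1 hk).2 (hclose k h.1 h.2)
    omega

end FigureExchange

/-! ### Rectangles are figures -/

section Rectangle

variable {d : ℕ}

/-- By Mazur–Ulam the isometry is affine, a linear isometry followed by a translation. -/
theorem measurePreserving_isometryEquiv
    (g : EuclideanSpace ℝ (Fin d) ≃ᵢ EuclideanSpace ℝ (Fin d)) :
    MeasurePreserving g volume volume := by
  let f := g.toRealAffineIsometryEquiv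
  have h : ∀ x, g x = f.linearIsometryEquiv x + g 0 := by
    intro x
    have := f.map_vadd 0 x
    simpa [f] using this
  have h2 := (measurePreserving_add_right (volume : Measure (EuclideanSpace ℝ (Fin d))) (g 0)).comp
    f.linearIsometryEquiv.measurePreserving
  have h3 : (g : EuclideanSpace ℝ (Fin d) → EuclideanSpace ℝ (Fin d)) =
      (fun x => x + g 0) ∘ f.linearIsometryEquiv := funext h
  rw [h3]
  exact h2

/-- The part of a box near a hyperplane parallel to a face. -/
def slab (a b : Fin d → ℝ) (k : Fin d) (c r : ℝ) : Set (EuclideanSpace ℝ (Fin d)) :=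
  {x | ∀ j, x j ∈ if j = k then Icc (c - r) (c + r) else Icc (a j - 1) (b j + 1)}

theorem volume_slab_le {a b : Fin d → ℝ} (hab : ∀ k, a k < b k) (k : Fin d) (c : ℝ) {r : ℝ}
    (hr : 0 < r) :
    volume (slab a b k c r) ≤ ENNReal.ofReal ((∏ j, (b j - a j + 2)) * (2 * r)) := by
  have hs : slab a b k c r = WithLp.ofLp ⁻¹' (univ.pi fun j =>
      if j = k then Icc (c - r) (c + r) else Icc (a j - 1) (b j + 1)) := by
    ext x; simp [slab]
  have hm : MeasurableSet (univ.pi fun j : Fin d =>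
      if j = k then Icc (c - r) (c + r) else Icc (a j - 1) (b j + 1)) := by
    refine MeasurableSet.univ_pi fun j => ?_
    split_ifs <;> exact measurableSet_Icc
  rw [hs, (PiLp.volume_preserving_ofLp (Fin d)).measure_preimage hm.nullMeasurableSet, volume_pi_pi]
  -- Since `b j - a j + 2 ≥ 1`, this factor may be kept in the thin direction too, which makes the
  -- bound independent of `k`.
  have h1 : ∀ j, volume (if j = k then Icc (c - r) (c + r) else Icc (a j - 1) (b j + 1)) ≤
      ENNReal.ofReal ((b j - a j + 2) * if j = k then 2 * r else 1) := by
    intro j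
    have := hab j
    split_ifs
    · rw [Real.volume_Icc]
      refine ENNReal.ofReal_le_ofReal ?_
      nlinarith
    · rw [Real.volume_Icc]
      refine ENNReal.ofReal_le_ofReal ?_
      linarith
  refine (Finset.prod_le_prod' fun j _ => h1 j).trans ?_
  rw [← ENNReal.ofReal_prod_of_nonneg, Finset.prod_mul_distrib]
  · simp
  · intro j _
    have := hab j
    refine mul_nonneg (by linarith) ?_
    split_ifs <;> positivity

/-- The frontier lies in the moved faces, so its `r`-neighbourhood is covered by `2 d` slabs of
thickness `2 r`; the exponent is `s = 1`. -/
theorem IsRectangle.isFigure {F : Set (EuclideanSpace ℝ (Fin d))} (hF : IsRectangle F) :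
    IsFigure F := by
  obtain ⟨a, b, g, hab, h1, h2⟩ := hF
  set U : Set (EuclideanSpace ℝ (Fin d)) := {x | ∀ k, a k < x k ∧ x k < b k} with hU
  set Q : Set (EuclideanSpace ℝ (Fin d)) := {x | ∀ k, a k ≤ x k ∧ x k ≤ b k} with hQ
  have hcont : ∀ k, Continuous fun x : EuclideanSpace ℝ (Fin d) => x k := fun k => by fun_prop
  have hUo : IsOpen U := by
    rw [hU]
    simp only [ofPred_forall]
    exact isOpen_iInter_of_finite fun k =>
      (isOpen_lt continuous_const (hcont k)).inter (isOpen_lt (hcont k) continuous_const)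
  have hQc : IsClosed Q := by
    rw [hQ]
    simp only [ofPred_forall]
    exact isClosed_iInter fun k =>
      (isClosed_le continuous_const (hcont k)).inter (isClosed_le (hcont k) continuous_const)
  have hgU : IsOpen (g '' U) := g.toHomeomorph.isOpenMap U hUo
  have hgQ : IsClosed (g '' Q) := g.toHomeomorph.isClosedMap Q hQc
  have hfr : frontier F ⊆ g '' (Q \ U) := by
    rw [image_sdiff g.injective]
    exact fun x hx => ⟨closure_minimal h2 hgQ hx.1, fun h => hx.2 (interior_maximal h1 hgU h)⟩
  have hQb : Bornology.IsBounded Q := by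
    refine ((PiLp.antilipschitzWith_ofLp 2 fun _ : Fin d => ℝ).isBounded_preimage
      (Metric.isBounded_Icc a b)).subset fun x hx => ?_
    exact ⟨fun k => (hx k).1, fun k => (hx k).2⟩
  refine ⟨(g.isometry.lipschitz.isBounded_image hQb).subset h2,
    d * (4 * ∏ j, (b j - a j + 2)), 1, one_pos, fun r hr hr1 => ?_⟩
  have hsub : Metric.thickening r (frontier F) ⊆
      g.symm ⁻¹' ⋃ k, (slab a b k (a k) r ∪ slab a b k (b k) r) := by
    intro y hy
    obtain ⟨z, hz, hyz⟩ := Metric.mem_thickening_iff.1 hy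
    obtain ⟨u, ⟨huQ, huU⟩, rfl⟩ := hfr hz
    have hd : dist (g.symm y) u < r := by
      rw [← g.symm_apply_apply u, g.symm.dist_eq]
      simpa using hyz
    set v := g.symm y
    have hj : ∀ j, |v j - u j| < r := fun j => by
      rw [dist_eq_norm] at hd
      exact (PiLp.norm_apply_le (v - u) j).trans_lt hd
    have hk : ∃ k, ¬ (a k < u k ∧ u k < b k) := not_forall.1 huU
    obtain ⟨k, hk⟩ := hk
    refine mem_iUnion.2 ⟨k, ?_⟩
    have hbox : ∀ j, v j ∈ Icc (a j - 1) (b j + 1) := fun j => by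
      have h1 := huQ j
      have h2 := abs_lt.1 (hj j)
      constructor <;> linarith
    have hab' : u k = a k ∨ u k = b k := by
      by_contra! h
      exact hk ⟨lt_of_le_of_ne (huQ k).1 h.1.symm, lt_of_le_of_ne (huQ k).2 h.2⟩
    have hk2 := abs_lt.1 (hj k)
    rcases hab' with h | h
    · left
      intro j
      split_ifs with hjk
      · subst hjk; rw [h] at hk2; constructor <;> linarith
      · exact hbox j
    · right
      intro j
      split_ifs with hjk
      · subst hjk; rw [h] at hk2; constructor <;> linarith
      · exact hbox j
  have hprod : 0 ≤ (∏ j, (b j - a j + 2)) * (2 * r) := by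
    refine mul_nonneg (Finset.prod_nonneg fun j _ => ?_) (by positivity)
    have := hab j
    linarith
  calc volume (Metric.thickening r (frontier F))
      ≤ volume (g.symm ⁻¹' ⋃ k, (slab a b k (a k) r ∪ slab a b k (b k) r)) := measure_mono hsub
    _ = volume (⋃ k, (slab a b k (a k) r ∪ slab a b k (b k) r)) :=
        (measurePreserving_isometryEquiv g.symm).measure_preimage_emb
          g.symm.toHomeomorph.measurableEmbedding _
    _ ≤ ∑ k : Fin d, (ENNReal.ofReal ((∏ j, (b j - a j + 2)) * (2 * r)) +
          ENNReal.ofReal ((∏ j, (b j - a j + 2)) * (2 * r))) := by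
        refine (measure_iUnion_fintype_le _ _).trans (Finset.sum_le_sum fun k _ => ?_)
        exact (measure_union_le _ _).trans
          (add_le_add (volume_slab_le hab k _ hr) (volume_slab_le hab k _ hr))
    _ = ENNReal.ofReal (d * (4 * ∏ j, (b j - a j + 2)) * r ^ (1 : ℝ)) := by
        rw [← ENNReal.ofReal_add hprod hprod, Finset.sum_const, Finset.card_univ, Fintype.card_fin,
          nsmul_eq_mul, ← ENNReal.ofReal_natCast, ← ENNReal.ofReal_mul (Nat.cast_nonneg d),
          Real.rpow_one]
        congr 1
        ring

end Rectangle

end GenericExchange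

end

/-- One dense Gδ serves both claims: its members are complex at infinitely many `m`, whereas an
automorphism isomorphic to a figure exchange is complex at only finitely many. -/
theorem mainTheorem3 {X : Type*} [MeasurableSpace X] [StandardBorelSpace X]
    (μ : MeasureTheory.Measure X) [MeasureTheory.IsProbabilityMeasure μ]
    [MeasureTheory.NullSingletonClass μ]
    (A : ℕ → Set X) (hA : GenericExchange.IsDenseFamily μ A) :
    GenericExchange.IsGenericProperty μ A
      (fun T => ∀ (d : ℕ) (E : GenericExchange.IsometricExchange d),
        E.IsFigureExchange → ¬ T.IsomorphicToExchange E) ∧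
    GenericExchange.IsGenericProperty μ A
      (fun T => ∀ (d : ℕ) (E : GenericExchange.IsometricExchange d),
        E.IsRectangleExchange → ¬ T.IsomorphicToExchange E) := by
  obtain ⟨B, hB, hB2⟩ := GenericExchange.exists_measure_eq_half μ
  obtain ⟨W, hW, hWd, hWc⟩ := GenericExchange.isGeneric_frequently_complex hA hB hB2
  have key : ∀ T ∈ W, ∀ (d : ℕ) (E : GenericExchange.IsometricExchange d),
      E.IsFigureExchange → ¬ T.IsomorphicToExchange E := by
    rintro T hT d E hE ⟨S, hS, hiso⟩
    obtain ⟨N, hN⟩ := eventually_atTop.1 (GenericExchange.eventually_not_isComplexAt hE hiso hB)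
    obtain ⟨m, hm, hmT⟩ := hWc T hT N
    exact hN m hm (hmT S hS)
  exact ⟨⟨W, hW, hWd, key⟩, ⟨W, hW, hWd, fun T hT d E hE =>
    key T hT d E fun i => (hE i).isFigure⟩⟩
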